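/- Fix integers $m,q\ge 1$. Write $W_k(n,\Sigma)$ for the (possibly singular) Wishart distribution of dimension $k$ with $n$ degrees of freedom and scale matrix $\Sigma$, i.e. the law of $XX^T$ where the $k\times n$ matrix $X$ has independent columns distributed as $N_k(0,\Sigma)$. For every $p$ let $\Sigma=\Sigma_p$ be a symmetric positive definite $p\times p$ matrix, put $a_i=a_i(p)=\operatorname{tr}(\Sigma_p^i)/p$ and $b=b(p)=a_1^2/a_2$, and assume that $$\frac{a_4}{p\,a_2^2}=\frac{\operatorname{tr}\Sigma_p^4}{(\operatorname{tr}\Sigma_p^2)^2}\longrightarrow 0\qquad(p\to\infty)$$ (for instance, that $a_2$ stays bounded away from $0$ and $a_4$ stays bounded). Let $A\sim W_p(m,\Sigma_p)$ and $B\sim W_p(q,\Sigma_p)$ be independent. For $p\ge m$, almost surely $A=HLH^T$ with $H$ a $p\times m$ matrix with orthonormal columns and $L$ a diagonal $m\times m$ matrix with positive diagonal entries; then $T_1=HL^{-1/2}$ satisfies $T_1^TAT_1=I_m$. Let $\lambda_{\max}=\lambda_{\max}(p)$ be the largest eigenvalue of the doubly singular beta matrix $T_1^TBT_1$ (it does not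 depend on the choice of $H$ and $L$). Then, as $p\to\infty$ with $m$ and $q$ fixed, $\lambda_{\max}$ is asymptotically distributed as the largest eigenvalue of $\frac{1}{pb}W_q(m,I_q)$; that is, $p\,b\,\lambda_{\max}$ converges in distribution to the largest eigenvalue of a $W_q(m,I_q)$ matrix. -/

import Mathlib

open MeasureTheory ProbabilityTheory Filter Topology Matrix

noncomputable section

/-- The product (equivalently Borel) `σ`-algebra on real matrices. -/
instance matrixMeasurableSpace {k l : ℕ} : MeasurableSpace (Matrix (Fin k) (Fin l) ℝ) :=
  inferInstanceAs (MeasurableSpace (Fin k → Fin l → ℝ))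

/-- The `k × n` matrix whose columns are the given `n` vectors of `ℝᵏ`. -/
def columnMatrix {k n : ℕ} (v : Fin n → EuclideanSpace ℝ (Fin k)) :
    Matrix (Fin k) (Fin n) ℝ :=
  Matrix.of fun i j => v j i

/-- The (central, possibly singular) Wishart distribution `W_k(n, S)` of dimension `k` with `n`
degrees of freedom and scale matrix `S`: the law of `X Xᵀ = ∑ⱼ vⱼ vⱼᵀ`, where
`X = (v₁, …, vₙ)` has independent columns `vⱼ ∼ N_k(0, S)`. -/
def wishart (k n : ℕ) (S : Matrix (Fin k) (Fin k) ℝ) : Measure (Matrix (Fin k) (Fin k) ℝ) :=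
  Measure.map (fun v => columnMatrix v * (columnMatrix v)ᵀ)
    (Measure.pi fun _ : Fin n => multivariateGaussian (0 : EuclideanSpace ℝ (Fin k)) S)

/-- The largest real eigenvalue of a square real matrix (here only used for symmetric matrices of
positive size, whose set of eigenvalues is finite, real and nonempty). -/
def maxEig {k : ℕ} (M : Matrix (Fin k) (Fin k) ℝ) : ℝ :=
  sSup (spectrum ℝ M)

/-- `T = H L^{-1/2}`, where `A = H L Hᵀ`, the columns of the `p × m` matrix `H` are orthonormal
eigenvectors of `A`, and the diagonal matrix `L` holds the `m` positive eigenvalues of `A`.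
Then `Tᵀ A T = I_m`. -/
def IsWhitening {p m : ℕ} (A : Matrix (Fin p) (Fin p) ℝ) (T : Matrix (Fin p) (Fin m) ℝ) : Prop :=
  ∃ (H : Matrix (Fin p) (Fin m) ℝ) (l : Fin m → ℝ),
    Hᵀ * H = 1 ∧ (∀ i, 0 < l i) ∧ A = H * diagonal l * Hᵀ ∧
      T = H * diagonal fun i => (√(l i))⁻¹

lemma IsWhitening.transpose_mul_mul {p m : ℕ} {A : Matrix (Fin p) (Fin p) ℝ}
    {T : Matrix (Fin p) (Fin m) ℝ} (h : IsWhitening A T) : Tᵀ * A * T = 1 := by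
  obtain ⟨H, l, hH, hl, rfl, rfl⟩ := h
  simp only [transpose_mul, diagonal_transpose]
  calc _ = diagonal (fun i => (√(l i))⁻¹) * (Hᵀ * H) * diagonal l * (Hᵀ * H)
          * diagonal (fun i => (√(l i))⁻¹) := by simp only [Matrix.mul_assoc]
    _ = 1 := by
      rw [hH, Matrix.mul_one, Matrix.mul_one, diagonal_mul_diagonal, diagonal_mul_diagonal,
        ← diagonal_one]
      congr 1
      funext i
      have h1 : 0 < √(l i) := Real.sqrt_pos.2 (hl i)
      have h2 : √(l i) * √(l i) = l i := Real.mul_self_sqrt (hl i).le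
      field_simp
      nlinarith

/-- The largest root of the doubly singular beta ensemble built from `A` (of rank `m`) and `B`:
the largest eigenvalue of the doubly singular beta matrix `Tᵀ B T`, `T = H L^{-1/2}`. By
`spectrum_eq_of_isWhitening` below, the eigenvalues do not depend on the choice of `T`. -/
def betaLargestRoot {p : ℕ} (m : ℕ) (A B : Matrix (Fin p) (Fin p) ℝ) : ℝ :=
  sSup {x : ℝ | ∃ T : Matrix (Fin p) (Fin m) ℝ, IsWhitening A T ∧ x ∈ spectrum ℝ (Tᵀ * B * T)}

lemma spectrum_eq_of_isWhitening {p m : ℕ} {A : Matrix (Fin p) (Fin p) ℝ}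
    {T T' : Matrix (Fin p) (Fin m) ℝ} (h : IsWhitening A T) (h' : IsWhitening A T')
    (B : Matrix (Fin p) (Fin p) ℝ) :
    spectrum ℝ (Tᵀ * B * T) = spectrum ℝ (T'ᵀ * B * T') := by
  have hA := h.transpose_mul_mul
  have hA' := h'.transpose_mul_mul
  have hTO : T * (Tᵀ * A * T') = T' := by
    obtain ⟨H, l, hH, hl, hAH, rfl⟩ := h
    obtain ⟨H', l', hH', hl', hAH', rfl⟩ := h'
    have e1 : (diagonal fun i => (√(l i))⁻¹) * (diagonal fun i => (√(l i))⁻¹) * diagonal l = 1 := by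
      rw [diagonal_mul_diagonal, diagonal_mul_diagonal, ← diagonal_one]
      congr 1
      funext i
      have h1 : 0 < √(l i) := Real.sqrt_pos.2 (hl i)
      have h2 : √(l i) * √(l i) = l i := Real.mul_self_sqrt (hl i).le
      field_simp
      nlinarith
    have e2 : A * (H' * diagonal fun i => (l' i)⁻¹) = H' := by
      rw [hAH', Matrix.mul_assoc, ← Matrix.mul_assoc H'ᵀ, hH', Matrix.one_mul, Matrix.mul_assoc,
        diagonal_mul_diagonal]
      have : (fun i => l' i * (l' i)⁻¹) = fun _ => (1 : ℝ) := by
        funext i; exact mul_inv_cancel₀ (hl' i).ne'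
      rw [this, diagonal_one, Matrix.mul_one]
    have e3 : H * Hᵀ * A = A := by
      rw [hAH]
      calc _ = H * (Hᵀ * H) * diagonal l * Hᵀ := by simp only [Matrix.mul_assoc]
        _ = _ := by rw [hH, Matrix.mul_one]
    have e4 : H * Hᵀ * H' = H' := by
      rw [← e2, ← Matrix.mul_assoc, e3]
    rw [← Matrix.mul_assoc, hAH, transpose_mul, diagonal_transpose]
    calc _ = H * ((diagonal fun i => (√(l i))⁻¹) * (diagonal fun i => (√(l i))⁻¹) * (Hᵀ * H)
            * diagonal l) * Hᵀ * H' * diagonal (fun i => (√(l' i))⁻¹) := by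
            simp only [Matrix.mul_assoc]
      _ = _ := by rw [hH, Matrix.mul_one, e1, Matrix.mul_one, e4]
  set O : Matrix (Fin m) (Fin m) ℝ := Tᵀ * A * T' with hO
  have hOO : Oᵀ * O = 1 := by
    have : T'ᵀ * A * T' = Oᵀ * O := by
      rw [← hTO, transpose_mul]
      calc _ = Oᵀ * (Tᵀ * A * T) * O := by simp only [Matrix.mul_assoc]
        _ = _ := by rw [hA, Matrix.mul_one]
    rw [← this, hA']
  let u : (Matrix (Fin m) (Fin m) ℝ)ˣ := ⟨O, Oᵀ, mul_eq_one_comm.1 hOO, hOO⟩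
  have hu : T'ᵀ * B * T' = (u⁻¹).val * (Tᵀ * B * T) * u.val := by
    rw [← hTO, transpose_mul]
    change _ = Oᵀ * (Tᵀ * B * T) * O
    simp only [Matrix.mul_assoc]
  rw [hu]
  exact (spectrum.units_conjugate' (a := Tᵀ * B * T) (u := u)).symm

/-- The normalized trace `a_i = tr(Sⁱ) / p` of the `i`-th power of a `p × p` scale matrix. -/
def scaleMoment {p : ℕ} (S : Matrix (Fin p) (Fin p) ℝ) (i : ℕ) : ℝ :=
  (S ^ i).trace / p

/-- The scale correction `b = a₁² / a₂`. -/
def scaleCorrection {p : ℕ} (S : Matrix (Fin p) (Fin p) ℝ) : ℝ :=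
  scaleMoment S 1 ^ 2 / scaleMoment S 2

end

/-! Write `A = X Xᵀ`, `B = Y Yᵀ` with independent Gaussian columns. Since `T` has its columns in the
range of `X` and `Xᵀ T` is orthogonal, the largest root is `‖Yᵀ X (Xᵀ X)⁻¹‖²`
(`betaLargestRoot_gram`). As `p b = (tr S)² / tr S²`, the scaled root is the squared operator norm
of `(Yᵀ X / √(tr S²)) (Xᵀ X / tr S)⁻¹` (`betaLargestRoot_eq_sqNormMul`).

Given `Y`, the rows of `Xᵀ Y` are independent `N(0, Yᵀ S Y)`, and `Yᵀ S Y / tr S²` tends to `I` in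
`L¹` with error of order `√(tr S⁴) / tr S²`, which vanishes by hypothesis. Hence `Xᵀ Y / √(tr S²)`
converges to a standard Gaussian matrix, by characteristic functions
(`norm_charFun_crossVec_sub_le`). Likewise `Xᵀ X / tr S` tends to `I` with error of order `√(tr S²)
/ tr S`, controlled by the same hypothesis through `trace_sq_cube_le`. Both estimates are instances
of `integral_abs_gram_sub_le`.

Slutsky's theorem and continuity of the norm give the limit `‖Z‖²` with `Z` a `q × m` standard
Gaussian matrix, that is, the largest eigenvalue of `Z Zᵀ`. -/

noncomputable section

/-! ### Largest eigenvalues of Gram matrices as operator norms. -/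

section OperatorNorm

open scoped Matrix.Norms.L2Operator

lemma l2_opNorm_transpose {k n : ℕ} (C : Matrix (Fin k) (Fin n) ℝ) : ‖Cᵀ‖ = ‖C‖ := by
  rw [← conjTranspose_eq_transpose_of_trivial, l2_opNorm_conjTranspose]

lemma l2_opNorm_transpose_mul_self {k n : ℕ} (C : Matrix (Fin k) (Fin n) ℝ) :
    ‖Cᵀ * C‖ = ‖C‖ ^ 2 := by
  rw [← conjTranspose_eq_transpose_of_trivial, l2_opNorm_conjTranspose_mul_self, sq]

/-- Unitary diagonalisation; nonnegative eigenvalues make their maximum equal to their sup norm.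
This trades a supremum over a spectrum for a continuous function. -/
lemma maxEig_eq_norm_of_posSemidef {k : ℕ} (hk : 1 ≤ k) {M : Matrix (Fin k) (Fin k) ℝ}
    (hM : M.PosSemidef) : maxEig M = ‖M‖ := by
  have : Nonempty (Fin k) := ⟨⟨0, hk⟩⟩
  set e := hM.1.eigenvalues
  have h0 : ∀ i, 0 ≤ e i := hM.eigenvalues_nonneg
  have h1 : ‖M‖ = ‖e‖ := by
    conv_lhs => rw [hM.1.spectral_theorem]
    rw [Unitary.conjStarAlgAut_apply, CStarRing.norm_mul_mem_unitary _
      (Unitary.star_mem (hM.1.eigenvectorUnitary).2),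
      CStarRing.norm_coe_unitary_mul, l2_opNorm_diagonal]
    rfl
  have hb : BddAbove (Set.range e) := (Set.finite_range e).bddAbove
  rw [maxEig, hM.1.spectrum_real_eq_range_eigenvalues, h1]
  apply le_antisymm
  · exact csSup_le (Set.range_nonempty _) (by
      rintro _ ⟨i, rfl⟩
      exact (le_abs_self _).trans (norm_le_pi_norm e i))
  · have hs : ∀ i, e i ≤ sSup (Set.range e) := fun i => le_csSup hb ⟨i, rfl⟩
    refine (pi_norm_le_iff_of_nonneg ((h0 (Classical.arbitrary _)).trans (hs _))).2 fun i => ?_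
    rw [Real.norm_of_nonneg (h0 i)]
    exact hs i

lemma maxEig_transpose_mul_self {k n : ℕ} (hn : 1 ≤ n) (C : Matrix (Fin k) (Fin n) ℝ) :
    maxEig (Cᵀ * C) = ‖C‖ ^ 2 := by
  have := posSemidef_conjTranspose_mul_self C
  rw [conjTranspose_eq_transpose_of_trivial] at this
  rw [maxEig_eq_norm_of_posSemidef hn this, l2_opNorm_transpose_mul_self]

lemma maxEig_mul_transpose_self {k n : ℕ} (hk : 1 ≤ k) (C : Matrix (Fin k) (Fin n) ℝ) :
    maxEig (C * Cᵀ) = ‖C‖ ^ 2 := by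
  have := maxEig_transpose_mul_self hk Cᵀ
  rwa [transpose_transpose, l2_opNorm_transpose] at this

lemma l2_opNorm_sq_le_iff {k n : ℕ} (C : Matrix (Fin k) (Fin n) ℝ) {t : ℝ} (ht : 0 ≤ t) :
    ‖C‖ ^ 2 ≤ t ↔ ∀ x : Fin n → ℝ, (C *ᵥ x) ⬝ᵥ (C *ᵥ x) ≤ t * (x ⬝ᵥ x) := by
  have key : ∀ {j : ℕ} (x : Fin j → ℝ), x ⬝ᵥ x = ‖WithLp.toLp 2 x‖ ^ 2 := fun x => by
    rw [EuclideanSpace.real_norm_sq_eq]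
    simp [dotProduct, sq]
  simp_rw [key]
  constructor
  · intro h x
    have := C.l2_opNorm_mulVec (WithLp.toLp 2 x)
    calc _ ≤ (‖C‖ * ‖WithLp.toLp 2 x‖) ^ 2 := by
          gcongr
          exact this
      _ = ‖C‖ ^ 2 * ‖WithLp.toLp 2 x‖ ^ 2 := by ring
      _ ≤ _ := by gcongr
  · intro h
    rw [← Real.sq_sqrt ht]
    gcongr
    rw [l2_opNorm_def]
    refine ContinuousLinearMap.opNorm_le_bound _ (Real.sqrt_nonneg _) fun x => ?_
    refine (sq_le_sq₀ (by positivity) (by positivity)).1 ?_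
    rw [mul_pow, Real.sq_sqrt ht]
    exact h x.ofLp

end OperatorNorm

/-! ### The largest root in terms of the data matrices. -/

section LargestRoot

open scoped Matrix.Norms.L2Operator

variable {p m q : ℕ}

lemma betaLargestRoot_eq_maxEig {A : Matrix (Fin p) (Fin p) ℝ} {T : Matrix (Fin p) (Fin m) ℝ}
    (h : IsWhitening A T) (B : Matrix (Fin p) (Fin p) ℝ) :
    betaLargestRoot m A B = maxEig (Tᵀ * B * T) := by
  rw [betaLargestRoot, maxEig]
  congr 1
  ext x
  constructor
  · rintro ⟨T', hT', hx⟩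
    rwa [spectrum_eq_of_isWhitening h hT']
  · exact fun hx => ⟨T, h, hx⟩

/-- Singular value decomposition: if `Xᵀ X = U diag(e) Uᵀ`, then `H = X U diag(e)^{-1/2}` has
orthonormal columns. -/
lemma exists_isWhitening (X : Matrix (Fin p) (Fin m) ℝ) (hX : (Xᵀ * X).det ≠ 0) :
    ∃ T : Matrix (Fin p) (Fin m) ℝ, IsWhitening (X * Xᵀ) T := by
  have hpsd : (Xᵀ * X).PosSemidef := by
    have := posSemidef_conjTranspose_mul_self X
    rwa [conjTranspose_eq_transpose_of_trivial] at this
  have hpd : (Xᵀ * X).PosDef := hpsd.posDef_iff_det_ne_zero.2 hX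
  set e := hpd.1.eigenvalues
  have hpos : ∀ i, 0 < e i := hpd.eigenvalues_pos
  set U : Matrix (Fin m) (Fin m) ℝ := hpd.1.eigenvectorUnitary.1
  have hUU : Uᵀ * U = 1 := by
    have := Unitary.coe_star_mul_self hpd.1.eigenvectorUnitary
    rwa [star_eq_conjTranspose, conjTranspose_eq_transpose_of_trivial] at this
  have hUU' : U * Uᵀ = 1 := mul_eq_one_comm.1 hUU
  have hspec : Xᵀ * X = U * diagonal e * Uᵀ := by
    have := hpd.1.spectral_theorem
    rw [Unitary.conjStarAlgAut_apply, star_eq_conjTranspose,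
      conjTranspose_eq_transpose_of_trivial] at this
    exact this
  set D : Matrix (Fin m) (Fin m) ℝ := diagonal fun i => (√(e i))⁻¹ with hD
  have hDT : Dᵀ = D := diagonal_transpose _
  have hDD : D * diagonal e * D = 1 := by
    rw [hD, diagonal_mul_diagonal, diagonal_mul_diagonal, ← diagonal_one]
    congr 1
    funext i
    have h1 : 0 < √(e i) := Real.sqrt_pos.2 (hpos i)
    have h2 : √(e i) * √(e i) = e i := Real.mul_self_sqrt (hpos i).le
    field_simp
    nlinarith
  refine ⟨X * U * D * D, X * U * D, e, ?_, hpos, ?_, ?_⟩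
  · calc _ = D * Uᵀ * (Xᵀ * X) * U * D := by
          simp only [transpose_mul, hDT, Matrix.mul_assoc]
      _ = D * (Uᵀ * U) * diagonal e * (Uᵀ * U) * D := by
          rw [hspec]
          simp only [Matrix.mul_assoc]
      _ = 1 := by rw [hUU, Matrix.mul_one, Matrix.mul_one, hDD]
  · calc X * Xᵀ = X * (U * Uᵀ) * Xᵀ := by rw [hUU', Matrix.mul_one]
      _ = X * U * (D * diagonal e * D) * Uᵀ * Xᵀ := by
          rw [hDD, Matrix.mul_one]
          simp only [Matrix.mul_assoc]
      _ = _ := by simp only [transpose_mul, hDT, Matrix.mul_assoc]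
  · rfl

/-- The projection `X (Xᵀ X)⁻¹ Xᵀ` fixes `T`, so `Yᵀ T = N (Xᵀ T)` with `N = Yᵀ X (Xᵀ X)⁻¹`. The
factor `Xᵀ T` is orthogonal because `Tᵀ A T = 1`, and it does not change the norm. -/
lemma betaLargestRoot_gram (hm : 1 ≤ m) (X : Matrix (Fin p) (Fin m) ℝ)
    (Y : Matrix (Fin p) (Fin q) ℝ) (hX : (Xᵀ * X).det ≠ 0) :
    betaLargestRoot m (X * Xᵀ) (Y * Yᵀ) = ‖Yᵀ * X * (Xᵀ * X)⁻¹‖ ^ 2 := by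
  obtain ⟨T, hT⟩ := exists_isWhitening X hX
  have hu : IsUnit (Xᵀ * X).det := isUnit_iff_ne_zero.2 hX
  rw [betaLargestRoot_eq_maxEig hT]
  have h1 : Tᵀ * (Y * Yᵀ) * T = (Yᵀ * T)ᵀ * (Yᵀ * T) := by
    simp only [transpose_mul, transpose_transpose, Matrix.mul_assoc]
  have hTAT := hT.transpose_mul_mul
  have hOO : (Xᵀ * T)ᵀ * (Xᵀ * T) = 1 := by
    rw [← hTAT]
    simp only [transpose_mul, transpose_transpose, Matrix.mul_assoc]
  have hPT : X * (Xᵀ * X)⁻¹ * Xᵀ * T = T := by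
    obtain ⟨H, l, hH, hl, hA, rfl⟩ := hT
    have e2 : X * Xᵀ * (H * diagonal fun i => (l i)⁻¹) = H := by
      rw [hA, Matrix.mul_assoc, ← Matrix.mul_assoc Hᵀ, hH, Matrix.one_mul, Matrix.mul_assoc,
        diagonal_mul_diagonal]
      have : (fun i => l i * (l i)⁻¹) = fun _ => (1 : ℝ) := by
        funext i; exact mul_inv_cancel₀ (hl i).ne'
      rw [this, diagonal_one, Matrix.mul_one]
    have e3 : X * (Xᵀ * X)⁻¹ * Xᵀ * H = H := by
      calc _ = X * (Xᵀ * X)⁻¹ * Xᵀ * (X * Xᵀ * (H * diagonal fun i => (l i)⁻¹)) := by rw [e2]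
        _ = X * ((Xᵀ * X)⁻¹ * (Xᵀ * X)) * Xᵀ * (H * diagonal fun i => (l i)⁻¹) := by
          simp only [Matrix.mul_assoc]
        _ = H := by rw [nonsing_inv_mul _ hu, Matrix.mul_one, e2]
    rw [← Matrix.mul_assoc, e3]
  have hN : Yᵀ * T = Yᵀ * X * (Xᵀ * X)⁻¹ * (Xᵀ * T) := by
    conv_lhs => rw [← hPT]
    simp only [Matrix.mul_assoc]
  rw [h1, maxEig_transpose_mul_self hm, hN, ← l2_opNorm_transpose, ← l2_opNorm_transpose_mul_self,
    ← l2_opNorm_transpose (Yᵀ * X * _), ← l2_opNorm_transpose_mul_self (Yᵀ * X * _)ᵀ]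
  congr 1
  set N := Yᵀ * X * (Xᵀ * X)⁻¹
  rw [transpose_mul N, transpose_mul _ Nᵀ, transpose_transpose, transpose_transpose]
  calc _ = N * ((Xᵀ * T) * (Xᵀ * T)ᵀ) * Nᵀ := by simp only [Matrix.mul_assoc]
    _ = _ := by rw [mul_eq_one_comm.1 hOO, Matrix.mul_one]

/-- The existence of `C` encodes full rank as a condition visibly open in `A`, as the measurability
proof requires. -/
lemma exists_det_ne_zero_of_isWhitening {A : Matrix (Fin p) (Fin p) ℝ}
    {T : Matrix (Fin p) (Fin m) ℝ} (h : IsWhitening A T) :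
    ∃ C : Matrix (Fin p) (Fin m) ℝ, (Cᵀ * A * C).det ≠ 0 :=
  ⟨T, by rw [h.transpose_mul_mul, det_one]; exact one_ne_zero⟩

lemma betaLargestRoot_eq_zero {A : Matrix (Fin p) (Fin p) ℝ}
    (h : ¬ ∃ C : Matrix (Fin p) (Fin m) ℝ, (Cᵀ * A * C).det ≠ 0) (B : Matrix (Fin p) (Fin p) ℝ) :
    betaLargestRoot m A B = 0 := by
  rw [betaLargestRoot]
  convert Real.sSup_empty
  ext x
  simp only [Set.mem_ofPred_eq, Set.mem_empty_iff_false, iff_false]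
  rintro ⟨T, hT, -⟩
  exact h (exists_det_ne_zero_of_isWhitening hT)

lemma det_transpose_mul_self_ne_zero {X : Matrix (Fin p) (Fin m) ℝ}
    (h : ∃ C : Matrix (Fin p) (Fin m) ℝ, (Cᵀ * (X * Xᵀ) * C).det ≠ 0) :
    (Xᵀ * X).det ≠ 0 := by
  obtain ⟨C, hC⟩ := h
  have h1 : Cᵀ * (X * Xᵀ) * C = (Cᵀ * X) * (Xᵀ * C) := by simp only [Matrix.mul_assoc]
  rw [h1, det_mul] at hC
  have hCX := left_ne_zero_of_mul hC
  have hrank : (Xᵀ * X).rank = m := by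
    rw [rank_transpose_mul_self]
    refine le_antisymm ((rank_le_width X)) ?_
    have := rank_mul_le_right Cᵀ X
    rwa [rank_of_det_ne_zero hCX, Fintype.card_fin] at this
  intro h0
  obtain ⟨v, hv, hv0⟩ := exists_mulVec_eq_zero_iff.2 h0
  have hr := (Xᵀ * X).mulVecLin.finrank_range_add_finrank_ker
  rw [Matrix.rank] at hrank
  rw [hrank, Module.finrank_fin_fun] at hr
  have hker : LinearMap.ker (Xᵀ * X).mulVecLin = ⊥ :=
    Submodule.finrank_eq_zero.1 (by omega)
  exact hv ((LinearMap.ker_eq_bot'.1 hker) v hv0)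

/-- With `x = Xᵀ X Xᵀ w`, the two forms are `|N x|²` and `|x|²` for `N = Yᵀ X (Xᵀ X)⁻¹`, and every
`x` arises because `Xᵀ X Xᵀ` is onto. The right side involves only `A` and `B`, not the choice of
`X` and `Y`. -/
lemma betaLargestRoot_gram_le_iff (hm : 1 ≤ m) (X : Matrix (Fin p) (Fin m) ℝ)
    (Y : Matrix (Fin p) (Fin q) ℝ) (hX : (Xᵀ * X).det ≠ 0) {t : ℝ} (ht : 0 ≤ t) :
    betaLargestRoot m (X * Xᵀ) (Y * Yᵀ) ≤ t ↔ ∀ w : Fin p → ℝ,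
      w ⬝ᵥ ((X * Xᵀ * (Y * Yᵀ) * (X * Xᵀ)) *ᵥ w) ≤
        t * (w ⬝ᵥ ((X * Xᵀ * (X * Xᵀ) * (X * Xᵀ)) *ᵥ w)) := by
  have hu : IsUnit (Xᵀ * X).det := isUnit_iff_ne_zero.2 hX
  rw [betaLargestRoot_gram hm X Y hX, l2_opNorm_sq_le_iff _ ht]
  have key : ∀ {j : ℕ} (C : Matrix (Fin j) (Fin p) ℝ) (w : Fin p → ℝ),
      (C *ᵥ w) ⬝ᵥ (C *ᵥ w) = w ⬝ᵥ ((Cᵀ * C) *ᵥ w) := fun C w => by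
    rw [← mulVec_mulVec, dotProduct_mulVec w, vecMul_transpose]
  have e1 : X * Xᵀ * (Y * Yᵀ) * (X * Xᵀ) = (Yᵀ * X * Xᵀ)ᵀ * (Yᵀ * X * Xᵀ) := by
    simp only [transpose_mul, transpose_transpose, Matrix.mul_assoc]
  have e2 : X * Xᵀ * (X * Xᵀ) * (X * Xᵀ) = (Xᵀ * X * Xᵀ)ᵀ * (Xᵀ * X * Xᵀ) := by
    simp only [transpose_mul, transpose_transpose, Matrix.mul_assoc]
  have e3 : Yᵀ * X * Xᵀ = Yᵀ * X * (Xᵀ * X)⁻¹ * (Xᵀ * X * Xᵀ) := by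
    calc _ = Yᵀ * X * ((Xᵀ * X)⁻¹ * (Xᵀ * X)) * Xᵀ := by
          rw [nonsing_inv_mul _ hu, Matrix.mul_one]
      _ = _ := by simp only [Matrix.mul_assoc]
  constructor
  · intro h w
    rw [e1, e2, ← key, ← key, e3, ← mulVec_mulVec]
    exact h _
  · intro h x
    -- A right inverse of `Xᵀ X Xᵀ`.
    have hs : (Xᵀ * X * Xᵀ) *ᵥ ((X * (Xᵀ * X)⁻¹ * (Xᵀ * X)⁻¹) *ᵥ x) = x := by
      rw [mulVec_mulVec]
      have : Xᵀ * X * Xᵀ * (X * (Xᵀ * X)⁻¹ * (Xᵀ * X)⁻¹)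
          = Xᵀ * X * ((Xᵀ * X) * (Xᵀ * X)⁻¹) * (Xᵀ * X)⁻¹ := by simp only [Matrix.mul_assoc]
      rw [this, mul_nonsing_inv _ hu, Matrix.mul_one, mul_nonsing_inv _ hu, one_mulVec]
    have := h ((X * (Xᵀ * X)⁻¹ * (Xᵀ * X)⁻¹) *ᵥ x)
    rwa [e1, e2, ← key, ← key, e3, ← mulVec_mulVec, hs] at this

end LargestRoot

/-! ### Measurability of the largest root. -/

section Measurability

instance matrixBorelSpace {k l : ℕ} : BorelSpace (Matrix (Fin k) (Fin l) ℝ) :=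
  inferInstanceAs (BorelSpace (Fin k → Fin l → ℝ))

instance matrixSecondCountable {k l : ℕ} :
    SecondCountableTopology (Matrix (Fin k) (Fin l) ℝ) :=
  inferInstanceAs (SecondCountableTopology (Fin k → Fin l → ℝ))

/-- On pairs of Gram matrices the largest root is measurable, because the condition
`betaLargestRoot m A B ≤ t` is the closed condition `A B A ≤ t A³` wherever `A` has rank `m`. -/
lemma aemeasurable_betaLargestRoot {p m q : ℕ} (hm : 1 ≤ m)
    {ν : Measure (Matrix (Fin p) (Fin p) ℝ × Matrix (Fin p) (Fin p) ℝ)}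
    (hν : ∀ᵐ z ∂ν, ∃ (X : Matrix (Fin p) (Fin m) ℝ) (Y : Matrix (Fin p) (Fin q) ℝ),
      z = (X * Xᵀ, Y * Yᵀ)) :
    AEMeasurable (fun z => betaLargestRoot m z.1 z.2) ν := by
  let U : Set (Matrix (Fin p) (Fin p) ℝ × Matrix (Fin p) (Fin p) ℝ) :=
    {z | ∃ C : Matrix (Fin p) (Fin m) ℝ, (Cᵀ * z.1 * C).det ≠ 0}
  have hU : MeasurableSet U := by
    have : U = ⋃ C : Matrix (Fin p) (Fin m) ℝ, {z | (Cᵀ * z.1 * C).det ≠ 0} := by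
      ext z
      simp [U]
    rw [this]
    refine (isOpen_iUnion fun C => ?_).measurableSet
    exact isOpen_ne_fun (by fun_prop) continuous_const
  let V : ℝ → Set (Matrix (Fin p) (Fin p) ℝ × Matrix (Fin p) (Fin p) ℝ) := fun t =>
    {z | ∀ w : Fin p → ℝ,
      w ⬝ᵥ ((z.1 * z.2 * z.1) *ᵥ w) ≤ t * (w ⬝ᵥ ((z.1 * z.1 * z.1) *ᵥ w))}
  have hV : ∀ t, MeasurableSet (V t) := fun t => by
    have : V t = ⋂ w : Fin p → ℝ, {z | w ⬝ᵥ ((z.1 * z.2 * z.1) *ᵥ w) ≤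
        t * (w ⬝ᵥ ((z.1 * z.1 * z.1) *ᵥ w))} := by
      ext z
      simp [V]
    rw [this]
    refine (isClosed_iInter fun w => ?_).measurableSet
    exact isClosed_le (by fun_prop) (by fun_prop)
  have hnull : NullMeasurable (fun z : Matrix (Fin p) (Fin p) ℝ × Matrix (Fin p) (Fin p) ℝ =>
      betaLargestRoot m z.1 z.2) ν := by
    refine @measurable_of_Iic ℝ (NullMeasurableSpace _ ν) _ _ _ _ _ _ _ _ fun t => ?_
    change NullMeasurableSet _ ν
    -- Off `U` the root takes its default value `0`, and it is never negative, so the sublevel set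
    -- is empty for `t < 0`.
    have hE : MeasurableSet ((U ∩ V t ∪ Uᶜ) ∩ {_z | 0 ≤ t}) :=
      ((hU.inter (hV t)).union hU.compl).inter (MeasurableSet.const _)
    refine hE.nullMeasurableSet.congr ?_
    filter_upwards [hν] with z hz
    obtain ⟨X, Y, rfl⟩ := hz
    apply propext
    change ((X * Xᵀ, Y * Yᵀ) ∈ U ∧ (X * Xᵀ, Y * Yᵀ) ∈ V t ∨ (X * Xᵀ, Y * Yᵀ) ∉ U) ∧ 0 ≤ t ↔
      betaLargestRoot m (X * Xᵀ) (Y * Yᵀ) ≤ t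
    by_cases h : (X * Xᵀ, Y * Yᵀ) ∈ U
    · have hX := det_transpose_mul_self_ne_zero h
      by_cases ht : 0 ≤ t
      · simp only [h, ht, true_and, not_true_eq_false, or_false, and_true]
        exact (betaLargestRoot_gram_le_iff hm X Y hX ht).symm
      · simp only [ht, and_false, false_iff, not_le]
        rw [betaLargestRoot_gram hm X Y hX]
        exact (not_le.1 ht).trans_le (by positivity)
    · rw [betaLargestRoot_eq_zero h]
      simp [h]
  exact hnull.aemeasurable

end Measurability

/-! ### Moments of Gaussian quadratic and bilinear forms. -/

section QuadraticForm

lemma integral_abs_le_sqrt_integral_sq {Ω : Type*} [MeasurableSpace Ω] {μ : Measure Ω}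
    [IsProbabilityMeasure μ] {f : Ω → ℝ} (hf : MemLp f 2 μ) :
    ∫ ω, |f ω| ∂μ ≤ √(∫ ω, f ω ^ 2 ∂μ) := by
  apply Real.le_sqrt_of_sq_le
  have h := variance_eq_sub hf.abs
  have h0 := variance_nonneg (|f|) μ
  have h1 : ∫ ω, f ω ^ 2 ∂μ = ∫ ω, (|f| ^ 2) ω ∂μ := by
    refine integral_congr_ae (ae_of_all _ fun ω => ?_)
    simp
  have h2 : ∫ ω, |f ω| ∂μ = ∫ ω, |f| ω ∂μ := rfl
  rw [h1, h2]
  linarith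

lemma memLp_two_sq_gaussianReal : MemLp (fun x : ℝ => x ^ 2) 2 (gaussianReal 0 1) := by
  rw [memLp_two_iff_integrable_sq (by fun_prop)]
  have := (memLp_id_gaussianReal (μ := 0) (v := 1) 4).integrable_norm_pow (by norm_num)
  refine this.congr (ae_of_all _ fun x => ?_)
  simp only [id, Real.norm_eq_abs]
  rw [← pow_mul]
  exact Even.pow_abs (by decide) x

lemma integral_sq_gaussianReal : ∫ x, x ^ 2 ∂(gaussianReal 0 1) = 1 := by
  have h := variance_eq_sub (μ := gaussianReal 0 1) (X := id) (memLp_id_gaussianReal 2)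
  rw [variance_id_gaussianReal] at h
  simp only [id, Pi.pow_apply, integral_id_gaussianReal] at h
  simpa using h.symm

variable {p : ℕ}

open scoped MatrixOrder in
lemma exists_symm_sqrt {S : Matrix (Fin p) (Fin p) ℝ} (hS : S.PosSemidef) :
    ∃ Q : Matrix (Fin p) (Fin p) ℝ, Qᵀ = Q ∧ Q * Q = S ∧
      multivariateGaussian 0 S =
        (stdGaussian (EuclideanSpace ℝ (Fin p))).map (toEuclideanCLM (𝕜 := ℝ) Q) := by
  refine ⟨CFC.sqrt S, ?_, CFC.sqrt_mul_sqrt_self S hS.nonneg, ?_⟩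
  · have := (CFC.sqrt_nonneg S).isSelfAdjoint
    rwa [isSelfAdjoint_iff, star_eq_conjTranspose, conjTranspose_eq_transpose_of_trivial] at this
  · simp [multivariateGaussian]

/-- A quadratic form in a centred Gaussian vector is distributed as a weighted sum of independent
`χ²₁` variables. -/
lemma identDistrib_quadForm {S Q R N : Matrix (Fin p) (Fin p) ℝ} (hQ : Qᵀ = Q)
    (hSQ : multivariateGaussian 0 S =
        (stdGaussian (EuclideanSpace ℝ (Fin p))).map (toEuclideanCLM (𝕜 := ℝ) Q))
    (hNQ : N = Q * R * Q) (hN : N.IsHermitian) :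
    IdentDistrib (fun y : EuclideanSpace ℝ (Fin p) => y.ofLp ⬝ᵥ (R *ᵥ y.ofLp))
      (∑ i, fun h : Fin p → ℝ => hN.eigenvalues i * h i ^ 2)
      (multivariateGaussian 0 S) (Measure.pi fun _ : Fin p => gaussianReal 0 1) where
  aemeasurable_fst := by
    apply Continuous.aemeasurable
    fun_prop
  aemeasurable_snd := by fun_prop
  map_eq := by
    have hc : Measurable fun y : EuclideanSpace ℝ (Fin p) => y.ofLp ⬝ᵥ (R *ᵥ y.ofLp) :=
      Continuous.measurable (by fun_prop)
    -- By rotation invariance the standard Gaussian may be expanded in the eigenbasis of `N`.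
    rw [hSQ, stdGaussian_eq_map_pi_orthonormalBasis hN.eigenvectorBasis,
      Measure.map_map hc (by fun_prop), Measure.map_map (by fun_prop) (by fun_prop)]
    congr 1
    funext h
    simp only [Function.comp_apply, Finset.sum_apply, ofLp_toEuclideanCLM]
    set x := ∑ i, h i • hN.eigenvectorBasis i with hx
    have hNx : toEuclideanCLM (𝕜 := ℝ) N x =
        ∑ i, (h i * hN.eigenvalues i) • hN.eigenvectorBasis i := by
      rw [hx, map_sum]
      refine Finset.sum_congr rfl fun i _ => ?_
      rw [map_smul, mul_smul]
      congr 1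
      ext j
      have := congrFun (hN.mulVec_eigenvectorBasis i) j
      rw [ofLp_toEuclideanCLM]
      simpa using this
    calc _ = x.ofLp ⬝ᵥ (N *ᵥ x.ofLp) := by
          rw [hNQ, ← mulVec_mulVec, ← mulVec_mulVec, dotProduct_mulVec x.ofLp Q]
          conv_rhs => rw [← hQ, vecMul_transpose, hQ]
      _ = _ := by
          rw [← inner_toEuclideanCLM, hNx, hx, hN.eigenvectorBasis.orthonormal.inner_sum]
          refine Finset.sum_congr rfl fun i _ => ?_
          simp
          ring

lemma trace_pow_eq_sum_eigenvalues_pow {N : Matrix (Fin p) (Fin p) ℝ} (hN : N.IsHermitian)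
    (k : ℕ) : (N ^ k).trace = ∑ i, hN.eigenvalues i ^ k := by
  conv_lhs => rw [hN.spectral_theorem, ← map_pow, Unitary.conjStarAlgAut_apply, trace_mul_comm,
    ← Matrix.mul_assoc, Unitary.coe_star_mul_self, Matrix.one_mul, diagonal_pow, trace_diagonal]
  simp

/-- The weights of the `χ²₁` variables are the eigenvalues of `Q R Q`, `Q = √S`; their sum and sum
of squares are the two traces. The variance of `χ²₁` is left unevaluated, since only its being a
constant matters. -/
lemma quadForm_moments {S R : Matrix (Fin p) (Fin p) ℝ} (hS : S.PosSemidef) (hR : Rᵀ = R) :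
    MemLp (fun y : EuclideanSpace ℝ (Fin p) => y.ofLp ⬝ᵥ (R *ᵥ y.ofLp)) 2
      (multivariateGaussian 0 S) ∧
    ∫ y, y.ofLp ⬝ᵥ (R *ᵥ y.ofLp) ∂(multivariateGaussian 0 S) = (R * S).trace ∧
    Var[fun y : EuclideanSpace ℝ (Fin p) => y.ofLp ⬝ᵥ (R *ᵥ y.ofLp); multivariateGaussian 0 S] =
      (R * S * R * S).trace * Var[fun x => x ^ 2; gaussianReal 0 1] := by
  obtain ⟨Q, hQ, hQQ, hSQ⟩ := exists_symm_sqrt hS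
  obtain ⟨N, hNQ⟩ : ∃ N, N = Q * R * Q := ⟨_, rfl⟩
  have hN : N.IsHermitian := by
    rw [IsHermitian, conjTranspose_eq_transpose_of_trivial, hNQ]
    simp only [transpose_mul, hQ, hR, Matrix.mul_assoc]
  have hid := identDistrib_quadForm hQ hSQ hNQ hN
  have hL : ∀ i, MemLp (fun x : ℝ => hN.eigenvalues i * x ^ 2) 2 (gaussianReal 0 1) :=
    fun i => memLp_two_sq_gaussianReal.const_mul _
  have hL' : ∀ i, MemLp (fun h : Fin p → ℝ => hN.eigenvalues i * h i ^ 2) 2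
      (Measure.pi fun _ : Fin p => gaussianReal 0 1) := fun i =>
    (hL i).comp_measurePreserving (measurePreserving_eval (fun _ : Fin p => gaussianReal 0 1) i)
  refine ⟨hid.symm.memLp_snd (memLp_finsetSum' _ fun i _ => hL' i), ?_, ?_⟩
  · rw [hid.integral_eq]
    simp only [Finset.sum_apply]
    rw [integral_finsetSum _ fun i _ => (hL' i).integrable (by norm_num)]
    have : ∀ i, ∫ h : Fin p → ℝ, hN.eigenvalues i * h i ^ 2
        ∂(Measure.pi fun _ : Fin p => gaussianReal 0 1) = hN.eigenvalues i := fun i => by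
      rw [integral_const_mul,
        integral_comp_eval (μ := fun _ : Fin p => gaussianReal 0 1) (i := i)
          (f := fun x : ℝ => x ^ 2) (by fun_prop),
        integral_sq_gaussianReal, mul_one]
    simp_rw [this]
    have htr := hN.trace_eq_sum_eigenvalues
    simp only [RCLike.ofReal_real_eq_id, id] at htr
    rw [← htr, hNQ, trace_mul_comm, ← Matrix.mul_assoc, hQQ, trace_mul_comm]
  · rw [hid.variance_eq, variance_sum_pi hL]
    simp_rw [variance_const_mul]
    rw [← Finset.sum_mul, ← trace_pow_eq_sum_eigenvalues_pow, sq, hNQ]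
    congr 1
    calc (Q * R * Q * (Q * R * Q)).trace = (Q * (R * (Q * Q) * R * Q)).trace := by
          simp only [Matrix.mul_assoc]
      _ = (R * (Q * Q) * R * (Q * Q)).trace := by
          rw [trace_mul_comm]
          simp only [Matrix.mul_assoc]
      _ = _ := by rw [hQQ]

lemma integral_abs_quadForm_sub_le {S R : Matrix (Fin p) (Fin p) ℝ} (hS : S.PosSemidef)
    (hR : Rᵀ = R) :
    ∫ y, |y.ofLp ⬝ᵥ (R *ᵥ y.ofLp) - (R * S).trace| ∂(multivariateGaussian 0 S) ≤
      √((R * S * R * S).trace * Var[fun x => x ^ 2; gaussianReal 0 1]) := by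
  obtain ⟨h1, h2, h3⟩ := quadForm_moments hS hR
  rw [← h3, variance_eq_integral h1.aemeasurable, h2]
  exact integral_abs_le_sqrt_integral_sq (h1.sub (memLp_const _))

lemma memLp_bilinForm (S R : Matrix (Fin p) (Fin p) ℝ) :
    MemLp (fun z : EuclideanSpace ℝ (Fin p) × EuclideanSpace ℝ (Fin p) =>
      z.1.ofLp ⬝ᵥ (R *ᵥ z.2.ofLp)) 2
      ((multivariateGaussian 0 S).prod (multivariateGaussian 0 S)) := by
  have hc : ∀ a, MemLp (fun y : EuclideanSpace ℝ (Fin p) => y a) 2 (multivariateGaussian 0 S) :=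
    fun a => (IsGaussian.memLp_two_id (μ := multivariateGaussian 0 S)).continuousLinearMap_comp
      (EuclideanSpace.proj a : EuclideanSpace ℝ (Fin p) →L[ℝ] ℝ)
  have hab : ∀ a b, MemLp (fun z : EuclideanSpace ℝ (Fin p) × EuclideanSpace ℝ (Fin p) =>
      z.1 a * (R a b * z.2 b)) 2
      ((multivariateGaussian 0 S).prod (multivariateGaussian 0 S)) := fun a b => by
    rw [memLp_two_iff_integrable_sq (by fun_prop)]
    simp_rw [mul_pow]
    exact (hc a).integrable_sq.mul_prod ((hc b).integrable_sq.const_mul (R a b ^ 2))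
  simp only [dotProduct, mulVec, Finset.mul_sum]
  exact memLp_finsetSum _ fun a _ => memLp_finsetSum _ fun b _ => hab a b

lemma integral_inner_sq {S : Matrix (Fin p) (Fin p) ℝ} (hS : S.PosSemidef) (u : Fin p → ℝ) :
    ∫ y, (y.ofLp ⬝ᵥ u) ^ 2 ∂(multivariateGaussian 0 S) = u ⬝ᵥ (S *ᵥ u) := by
  have h := covarianceBilin_multivariateGaussian (μ := 0) hS (WithLp.toLp 2 u) (WithLp.toLp 2 u)
  rw [covarianceBilin_self IsGaussian.memLp_two_id, variance_eq_integral (by fun_prop)] at h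
  have h0 : ∫ y, inner ℝ (WithLp.toLp 2 u) y ∂(multivariateGaussian 0 S) = 0 := by
    rw [integral_inner IsGaussian.integrable_fun_id]
    simp
  rw [h0] at h
  rw [← h]
  refine integral_congr_ae (ae_of_all _ fun y => ?_)
  simp [EuclideanSpace.inner_eq_star_dotProduct]

/-- Integrating out the first vector leaves the quadratic form of `R S R` in the second, whose mean
is known. -/
lemma integral_bilinForm_sq {S R : Matrix (Fin p) (Fin p) ℝ} (hS : S.PosSemidef) (hR : Rᵀ = R) :
    ∫ z, (z.1.ofLp ⬝ᵥ (R *ᵥ z.2.ofLp)) ^ 2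
      ∂((multivariateGaussian 0 S).prod (multivariateGaussian 0 S)) = (R * S * R * S).trace := by
  rw [integral_prod_symm _ (memLp_bilinForm S R).integrable_sq]
  simp_rw [integral_inner_sq hS]
  have hST : Sᵀ = S := by simpa using hS.1.eq
  rw [← (quadForm_moments hS (R := R * S * R) (by
    simp only [transpose_mul, hR, hST, Matrix.mul_assoc])).2.1]
  refine integral_congr_ae (ae_of_all _ fun y => ?_)
  simp only
  rw [← mulVec_mulVec, ← mulVec_mulVec, dotProduct_mulVec y.ofLp R]
  conv_rhs => rw [← hR, vecMul_transpose, hR]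

lemma integral_abs_bilinForm_le {S R : Matrix (Fin p) (Fin p) ℝ} (hS : S.PosSemidef)
    (hR : Rᵀ = R) :
    ∫ z, |z.1.ofLp ⬝ᵥ (R *ᵥ z.2.ofLp)|
      ∂((multivariateGaussian 0 S).prod (multivariateGaussian 0 S)) ≤
      √((R * S * R * S).trace) := by
  rw [← integral_bilinForm_sq hS hR]
  exact integral_abs_le_sqrt_integral_sq (memLp_bilinForm S R)

variable {n : ℕ}

lemma measurePreserving_eval_eval_pi {E : Type*} [MeasurableSpace E] (μ : Measure E)
    [IsProbabilityMeasure μ]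
    {i j : Fin n} (hij : i ≠ j) :
    MeasurePreserving (fun v : Fin n → E => (v i, v j)) (Measure.pi fun _ => μ) (μ.prod μ) where
  measurable := by fun_prop
  map_eq := by
    have h := (iIndepFun_pi (μ := fun _ : Fin n => μ) (X := fun _ => id)
      (fun _ => aemeasurable_id)).indepFun hij
    simp only [id] at h
    rw [indepFun_iff_map_prod_eq_prod_map_map (measurable_pi_apply i).aemeasurable
      (measurable_pi_apply j).aemeasurable] at h
    rw [h, (measurePreserving_eval (fun _ : Fin n => μ) i).map_eq,
      (measurePreserving_eval (fun _ : Fin n => μ) j).map_eq]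

lemma integrable_gram (S : Matrix (Fin p) (Fin p) ℝ) {R : Matrix (Fin p) (Fin p) ℝ}
    (hS : S.PosSemidef) (hR : Rᵀ = R) (i j : Fin n) :
    Integrable (fun v : Fin n → EuclideanSpace ℝ (Fin p) => (v i).ofLp ⬝ᵥ (R *ᵥ (v j).ofLp))
      (Measure.pi fun _ => multivariateGaussian 0 S) := by
  rcases eq_or_ne i j with rfl | hij
  · exact ((quadForm_moments hS hR).1.comp_measurePreserving
      (measurePreserving_eval _ i)).integrable (by norm_num)
  · exact ((memLp_bilinForm S R).comp_measurePreserving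
      (measurePreserving_eval_eval_pi _ hij)).integrable (by norm_num)

/-- The constant in the quantitative law of large numbers `integral_abs_gram_sub_le`. -/
def gramConst : ℝ := Var[fun x => x ^ 2; gaussianReal 0 1] + 1

/-- The entries of `Yᵀ R Y`, `Y` with independent `N(0, S)` columns, are close to those of
`tr (R S) I`. -/
lemma integral_abs_gram_sub_le {S R : Matrix (Fin p) (Fin p) ℝ} (hS : S.PosSemidef)
    (hR : Rᵀ = R) (i j : Fin n) :
    ∫ v, |(v i).ofLp ⬝ᵥ (R *ᵥ (v j).ofLp) - if i = j then (R * S).trace else 0|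
      ∂(Measure.pi fun _ : Fin n => multivariateGaussian 0 S) ≤
      √((R * S * R * S).trace * gramConst) := by
  have h0 : 0 ≤ (R * S * R * S).trace := by
    rw [← integral_bilinForm_sq hS hR]
    positivity
  have h1 := variance_nonneg (fun x : ℝ => x ^ 2) (gaussianReal 0 1)
  rcases eq_or_ne i j with rfl | hij
  · simp only [if_true]
    rw [integral_comp_eval (μ := fun _ : Fin n => multivariateGaussian 0 S) (i := i)
      (f := fun y : EuclideanSpace ℝ (Fin p) => |y.ofLp ⬝ᵥ (R *ᵥ y.ofLp) - (R * S).trace|)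
      (Continuous.aestronglyMeasurable (by fun_prop))]
    refine (integral_abs_quadForm_sub_le hS hR).trans (Real.sqrt_le_sqrt ?_)
    -- Diagonal entries use the variance summand of `gramConst`, off-diagonal ones the summand `1`.
    rw [gramConst]
    gcongr
    linarith
  · simp only [hij, if_false, sub_zero]
    have hm := measurePreserving_eval_eval_pi (n := n) (multivariateGaussian 0 S) hij
    have := integral_abs_bilinForm_le hS hR
    rw [← hm.map_eq, integral_map hm.measurable.aemeasurable
      (Continuous.aestronglyMeasurable (by fun_prop))] at this
    refine this.trans (Real.sqrt_le_sqrt ?_)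
    rw [gramConst]
    nlinarith

end QuadraticForm

/-! ### Trace inequalities and the normalisation in terms of traces. -/

section Trace

variable {p : ℕ}

/-- Cauchy–Schwarz twice on power sums of eigenvalues: `s₂² ≤ s₁ s₃` and `s₃² ≤ s₂ s₄`. For positive
traces it reads `tr S² / (tr S)² ≤ tr S⁴ / (tr S²)²`. -/
lemma trace_sq_cube_le {S : Matrix (Fin p) (Fin p) ℝ} (hS : S.PosSemidef) :
    (S ^ 2).trace ^ 3 ≤ S.trace ^ 2 * (S ^ 4).trace := by
  set e := hS.1.eigenvalues with he
  have h0 : ∀ i, 0 ≤ e i := hS.eigenvalues_nonneg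
  have h1 : S.trace = ∑ i, e i := by
    simpa using trace_pow_eq_sum_eigenvalues_pow hS.1 1
  rw [trace_pow_eq_sum_eigenvalues_pow hS.1, trace_pow_eq_sum_eigenvalues_pow hS.1, h1, ← he]
  have hA : (∑ i, e i ^ 2) ^ 2 ≤ (∑ i, e i) * ∑ i, e i ^ 3 :=
    Finset.sum_sq_le_sum_mul_sum_of_sq_le_mul _ (fun i _ => h0 i) (fun i _ => pow_nonneg (h0 i) 3)
      fun i _ => le_of_eq (by ring)
  have hB : (∑ i, e i ^ 3) ^ 2 ≤ (∑ i, e i ^ 2) * ∑ i, e i ^ 4 :=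
    Finset.sum_sq_le_sum_mul_sum_of_sq_le_mul _ (fun i _ => pow_nonneg (h0 i) 2)
      (fun i _ => pow_nonneg (h0 i) 4) fun i _ => le_of_eq (by ring)
  have hs1 : 0 ≤ ∑ i, e i := Finset.sum_nonneg fun i _ => h0 i
  have hs2 : 0 ≤ ∑ i, e i ^ 2 := Finset.sum_nonneg fun i _ => pow_nonneg (h0 i) 2
  have hs4 : 0 ≤ ∑ i, e i ^ 4 := Finset.sum_nonneg fun i _ => pow_nonneg (h0 i) 4
  rcases hs2.eq_or_lt with h | h
  · rw [← h, zero_pow three_ne_zero]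
    positivity
  refine le_of_mul_le_mul_right ?_ h
  calc _ = ((∑ i, e i ^ 2) ^ 2) ^ 2 := by ring
    _ ≤ ((∑ i, e i) * ∑ i, e i ^ 3) ^ 2 := by gcongr
    _ = (∑ i, e i) ^ 2 * (∑ i, e i ^ 3) ^ 2 := by ring
    _ ≤ (∑ i, e i) ^ 2 * ((∑ i, e i ^ 2) * ∑ i, e i ^ 4) := by gcongr
    _ = _ := by ring

lemma trace_pow_pos {S : Matrix (Fin p) (Fin p) ℝ} (hp : 1 ≤ p) (hS : S.PosDef) (k : ℕ) :
    0 < (S ^ k).trace := by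
  have : Nonempty (Fin p) := ⟨⟨0, hp⟩⟩
  rw [trace_pow_eq_sum_eigenvalues_pow hS.1]
  exact Finset.sum_pos (fun i _ => pow_pos (hS.eigenvalues_pos i) k) Finset.univ_nonempty

lemma scaleMoment_ratio_eq (hp : 1 ≤ p) (S : Matrix (Fin p) (Fin p) ℝ) :
    scaleMoment S 4 / (p * scaleMoment S 2 ^ 2) = (S ^ 4).trace / (S ^ 2).trace ^ 2 := by
  have : (0 : ℝ) < p := by exact_mod_cast hp
  rw [scaleMoment, scaleMoment]
  field_simp

lemma mul_scaleCorrection_eq (hp : 1 ≤ p) (S : Matrix (Fin p) (Fin p) ℝ) :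
    p * scaleCorrection S = S.trace ^ 2 / (S ^ 2).trace := by
  have : (0 : ℝ) < p := by exact_mod_cast hp
  rw [scaleCorrection, scaleMoment, scaleMoment, pow_one]
  field_simp

end Trace

/-! ### Characteristic functions of the scaled cross products. -/

section CharFun

variable {p m q : ℕ}

lemma abs_exp_sub_exp_le {a b : ℝ} (ha : a ≤ 0) (hb : b ≤ 0) :
    |Real.exp a - Real.exp b| ≤ |a - b| := by
  wlog h : a ≤ b generalizing a b
  · rw [abs_sub_comm, abs_sub_comm a]
    exact this hb ha (le_of_not_ge h)
  rw [abs_sub_comm, abs_sub_comm a, abs_of_nonneg (sub_nonneg.2 (Real.exp_le_exp.2 h)),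
    abs_of_nonneg (sub_nonneg.2 h)]
  have h1 := Real.add_one_le_exp (a - b)
  have h2 : Real.exp a = Real.exp b * Real.exp (a - b) := by rw [← Real.exp_add]; ring_nf
  have h3 : Real.exp b ≤ 1 := Real.exp_le_one_iff.2 hb
  have h4 := Real.exp_pos b
  rw [h2]
  nlinarith

lemma dotProduct_mulVec_sum_smul (S : Matrix (Fin p) (Fin p) ℝ) (a : Fin q → ℝ)
    (y : Fin q → Fin p → ℝ) :
    (∑ j, a j • y j) ⬝ᵥ (S *ᵥ ∑ j, a j • y j) =
      ∑ j, ∑ k, a j * a k * (y j ⬝ᵥ (S *ᵥ y k)) := by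
  rw [sum_dotProduct]
  refine Finset.sum_congr rfl fun j _ => ?_
  rw [mulVec_sum, dotProduct_sum]
  refine Finset.sum_congr rfl fun k _ => ?_
  rw [mulVec_smul, smul_dotProduct, dotProduct_smul]
  simp only [smul_eq_mul]
  ring

lemma integral_cexp_sum_dotProduct {S : Matrix (Fin p) (Fin p) ℝ} (hS : S.PosSemidef)
    (u : Fin m → Fin p → ℝ) :
    ∫ x, Complex.exp (((∑ i, (x i).ofLp ⬝ᵥ u i : ℝ) : ℂ) * Complex.I)
      ∂(Measure.pi fun _ : Fin m => multivariateGaussian (0 : EuclideanSpace ℝ (Fin p)) S) =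
    (Real.exp (-(∑ i, u i ⬝ᵥ (S *ᵥ u i)) / 2) : ℂ) := by
  have h := charFun_pi (μ := fun _ : Fin m => multivariateGaussian (0 : EuclideanSpace ℝ (Fin p)) S)
    (WithLp.toLp 2 fun i => WithLp.toLp 2 (u i))
  rw [charFun_apply, integral_map (by fun_prop)
    (Continuous.aestronglyMeasurable (by fun_prop))] at h
  convert h using 1
  · congr 1
    funext x
    congr 2
    rw [PiLp.inner_apply]
    congr 1
    refine Finset.sum_congr rfl fun i _ => ?_
    simp [EuclideanSpace.inner_eq_star_dotProduct, dotProduct_comm]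
  · simp_rw [charFun_multivariateGaussian hS]
    rw [← Complex.exp_sum, Complex.ofReal_exp]
    congr 1
    push_cast
    simp [Finset.sum_neg_distrib, Finset.sum_div, neg_div]

/-- The scaled cross products `Xᵀ Y / s`, as a Euclidean vector. -/
def crossVec (s : ℝ) (x : Fin m → EuclideanSpace ℝ (Fin p)) (y : Fin q → EuclideanSpace ℝ (Fin p)) :
    EuclideanSpace ℝ (Fin m × Fin q) :=
  WithLp.toLp 2 fun k => ((x k.1).ofLp ⬝ᵥ (y k.2).ofLp) / s

/-- The entries of an `m`-tuple of vectors of `ℝ^q`, as a Euclidean vector. -/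
def flattenVec (z : Fin m → EuclideanSpace ℝ (Fin q)) : EuclideanSpace ℝ (Fin m × Fin q) :=
  WithLp.toLp 2 fun k => z k.1 k.2

lemma continuous_crossVec (s : ℝ) :
    Continuous fun z : (Fin m → EuclideanSpace ℝ (Fin p)) × (Fin q → EuclideanSpace ℝ (Fin p)) =>
      crossVec s z.1 z.2 := by
  unfold crossVec
  fun_prop

lemma continuous_flattenVec :
    Continuous (flattenVec : (Fin m → EuclideanSpace ℝ (Fin q)) → _) := by
  unfold flattenVec
  fun_prop

/-- The law of `m` independent `N(0, S)` vectors. -/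
abbrev gaussianTuple (m : ℕ) (S : Matrix (Fin p) (Fin p) ℝ) :
    Measure (Fin m → EuclideanSpace ℝ (Fin p)) :=
  Measure.pi fun _ : Fin m => multivariateGaussian 0 S

/-- For fixed `y` the cross products are linear in the Gaussian `x`, so the inner integral is a
Gaussian characteristic function with covariance given by the `y j ⬝ᵥ S y k`. -/
lemma charFun_crossVec {S : Matrix (Fin p) (Fin p) ℝ} (hS : S.PosSemidef) (s : ℝ)
    (θ : EuclideanSpace ℝ (Fin m × Fin q)) :
    charFun (((gaussianTuple m S).prod (gaussianTuple q S)).map fun z => crossVec s z.1 z.2) θ =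
      ((∫ y, Real.exp (-(∑ i, ∑ j, ∑ k, θ (i, j) * θ (i, k) *
        (((y j).ofLp ⬝ᵥ (S *ᵥ (y k).ofLp)) / s ^ 2)) / 2) ∂(gaussianTuple q S) : ℝ) : ℂ) := by
  rw [charFun_apply, integral_map (continuous_crossVec s).aemeasurable
    (Continuous.aestronglyMeasurable (by fun_prop)), integral_prod_symm]
  · rw [← integral_complex_ofReal]
    refine integral_congr_ae (ae_of_all _ fun y => ?_)
    simp only
    set u : Fin m → Fin p → ℝ := fun i => ∑ j, (θ (i, j) / s) • (y j).ofLp with hu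
    have h := integral_cexp_sum_dotProduct hS u
    convert h using 1
    · refine integral_congr_ae (ae_of_all _ fun x => ?_)
      simp only
      congr 3
      rw [PiLp.inner_apply, Fintype.sum_prod_type]
      refine Finset.sum_congr rfl fun i _ => ?_
      rw [hu, dotProduct_sum]
      refine Finset.sum_congr rfl fun j _ => ?_
      simp [crossVec]
      ring
    · congr 4
      refine Finset.sum_congr rfl fun i _ => ?_
      rw [hu, dotProduct_mulVec_sum_smul]
      refine Finset.sum_congr rfl fun j _ => Finset.sum_congr rfl fun k _ => ?_
      ring
  · refine Integrable.of_bound (C := 1) ?_ (ae_of_all _ fun z => ?_)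
    · exact Continuous.aestronglyMeasurable (by
        have := continuous_crossVec (m := m) (q := q) (p := p) s
        fun_prop)
    · rw [Complex.norm_exp_ofReal_mul_I]

lemma charFun_flattenVec (θ : EuclideanSpace ℝ (Fin m × Fin q)) :
    charFun ((gaussianTuple m (1 : Matrix (Fin q) (Fin q) ℝ)).map flattenVec) θ =
      (Real.exp (-(∑ i, ∑ j, ∑ k, θ (i, j) * θ (i, k) * if j = k then 1 else 0) / 2) : ℂ) := by
  rw [charFun_apply, integral_map continuous_flattenVec.aemeasurable
    (Continuous.aestronglyMeasurable (by fun_prop))]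
  have h := integral_cexp_sum_dotProduct (p := q) PosSemidef.one fun (i : Fin m) j => θ (i, j)
  convert h using 1
  · refine integral_congr_ae (ae_of_all _ fun x => ?_)
    simp only
    congr 3
    rw [PiLp.inner_apply, Fintype.sum_prod_type]
    refine Finset.sum_congr rfl fun i _ => Finset.sum_congr rfl fun j _ => ?_
    simp [flattenVec, mul_comm]
  · simp [dotProduct]

/-- Both exponents are nonpositive, where `exp` is 1-Lipschitz, so the difference is at most the
`L¹` error of the covariance entries, bounded by `integral_abs_gram_sub_le` with `R = S`. -/
lemma norm_charFun_crossVec_sub_le (hp : 1 ≤ p) {S : Matrix (Fin p) (Fin p) ℝ} (hS : S.PosDef)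
    (θ : EuclideanSpace ℝ (Fin m × Fin q)) :
    ‖charFun (((gaussianTuple m S).prod (gaussianTuple q S)).map
        fun z => crossVec √((S ^ 2).trace) z.1 z.2) θ -
      charFun ((gaussianTuple m (1 : Matrix (Fin q) (Fin q) ℝ)).map flattenVec) θ‖ ≤
    (∑ i, ∑ j, ∑ k, |θ (i, j) * θ (i, k)|) *
      √((S ^ 4).trace / (S ^ 2).trace ^ 2 * gramConst) := by
  set c := (S ^ 2).trace with hc
  have hc0 : 0 < c := trace_pow_pos hp hS 2
  have hST : Sᵀ = S := by simpa using hS.1.eq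
  let G : (Fin q → EuclideanSpace ℝ (Fin p)) → Fin q → Fin q → ℝ :=
    fun y j k => (y j).ofLp ⬝ᵥ (S *ᵥ (y k).ofLp)
  let V : (Fin q → EuclideanSpace ℝ (Fin p)) → ℝ := fun y =>
    ∑ i, ∑ j, ∑ k, θ (i, j) * θ (i, k) * (G y j k / c)
  let v : ℝ := ∑ i, ∑ j, ∑ k, θ (i, j) * θ (i, k) * if j = k then 1 else 0
  have hV0 : ∀ y, 0 ≤ V y := fun y => Finset.sum_nonneg fun i _ => by
    have h := hS.posSemidef.dotProduct_mulVec_nonneg (∑ j, θ (i, j) • (y j).ofLp)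
    rw [star_trivial, dotProduct_mulVec_sum_smul] at h
    have h2 : ∑ j, ∑ k, θ (i, j) * θ (i, k) * (G y j k / c) =
        (∑ j, ∑ k, θ (i, j) * θ (i, k) * G y j k) / c := by
      simp_rw [Finset.sum_div, mul_div_assoc]
    rw [h2]
    exact div_nonneg h hc0.le
  have hv0 : 0 ≤ v := Finset.sum_nonneg fun i _ => by
    simp only [mul_ite, mul_one, mul_zero, Finset.sum_ite_eq, Finset.mem_univ, if_true]
    exact Finset.sum_nonneg fun j _ => mul_self_nonneg _
  have hVc : Continuous V := by fun_prop
  have hint : Integrable (fun y => Real.exp (-V y / 2)) (gaussianTuple q S) := by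
    refine Integrable.of_bound (C := 1) (Continuous.aestronglyMeasurable (by fun_prop))
      (ae_of_all _ fun y => ?_)
    rw [Real.norm_of_nonneg (Real.exp_pos _).le, Real.exp_le_one_iff]
    linarith [hV0 y]
  have hGint : ∀ j k, Integrable (fun y => |G y j k / c - if j = k then 1 else 0|)
      (gaussianTuple q S) := fun j k =>
    (((integrable_gram S hS.posSemidef hST j k).div_const c).sub (integrable_const _)).abs
  have hG : ∀ j k, ∫ y, |G y j k / c - if j = k then 1 else 0| ∂(gaussianTuple q S) ≤
      √((S ^ 4).trace / c ^ 2 * gramConst) := fun j k => by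
    have h := integral_abs_gram_sub_le hS.posSemidef hST j k
    have h4 : S * S * S * S = S ^ 4 := by noncomm_ring
    rw [h4, ← sq, ← hc] at h
    have e : ∀ y, |G y j k / c - if j = k then 1 else 0| =
        |G y j k - if j = k then c else 0| / c := fun y => by
      rw [← abs_of_pos hc0, ← abs_div, abs_of_pos hc0]
      congr 1
      split_ifs
      · field_simp
      · simp
    simp_rw [e]
    rw [integral_div, div_mul_eq_mul_div, Real.sqrt_div' _ (sq_nonneg c), Real.sqrt_sq hc0.le]
    gcongr
  have hbound : ∀ y, |Real.exp (-V y / 2) - Real.exp (-v / 2)| ≤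
      ∑ i, ∑ j, ∑ k, |θ (i, j) * θ (i, k)| * |G y j k / c - if j = k then 1 else 0| := fun y => by
    refine (abs_exp_sub_exp_le (by linarith [hV0 y]) (by linarith)).trans ?_
    have h1 : |-V y / 2 - -v / 2| ≤ |V y - v| := by
      rw [show -V y / 2 - -v / 2 = -((V y - v) / 2) by ring, abs_neg, abs_div,
        abs_of_pos (by norm_num : (0 : ℝ) < 2)]
      linarith [abs_nonneg (V y - v)]
    refine h1.trans ?_
    have h2 : V y - v = ∑ i, ∑ j, ∑ k, θ (i, j) * θ (i, k) *
        (G y j k / c - if j = k then 1 else 0) := by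
      simp only [V, v, ← Finset.sum_sub_distrib, mul_sub]
    rw [h2]
    refine (Finset.abs_sum_le_sum_abs _ _).trans (Finset.sum_le_sum fun i _ => ?_)
    refine (Finset.abs_sum_le_sum_abs _ _).trans (Finset.sum_le_sum fun j _ => ?_)
    refine (Finset.abs_sum_le_sum_abs _ _).trans (Finset.sum_le_sum fun k _ => ?_)
    rw [abs_mul]
  rw [charFun_crossVec hS.posSemidef, charFun_flattenVec, Real.sq_sqrt hc0.le,
    ← Complex.ofReal_sub, Complex.norm_real, Real.norm_eq_abs]
  change |∫ y, Real.exp (-V y / 2) ∂(gaussianTuple q S) - Real.exp (-v / 2)| ≤ _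
  calc _ = |∫ y, (Real.exp (-V y / 2) - Real.exp (-v / 2)) ∂(gaussianTuple q S)| := by
        rw [integral_sub hint (integrable_const _), integral_const]
        simp
    _ ≤ ∫ y, |Real.exp (-V y / 2) - Real.exp (-v / 2)| ∂(gaussianTuple q S) :=
        abs_integral_le_integral_abs
    _ ≤ ∫ y, ∑ i, ∑ j, ∑ k, |θ (i, j) * θ (i, k)| * |G y j k / c - if j = k then 1 else 0|
          ∂(gaussianTuple q S) := by
        refine integral_mono (hint.sub (integrable_const _)).abs ?_ hbound
        exact integrable_finsetSum _ fun i _ => integrable_finsetSum _ fun j _ =>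
          integrable_finsetSum _ fun k _ => (hGint j k).const_mul _
    _ = ∑ i, ∑ j, ∑ k, |θ (i, j) * θ (i, k)| *
          ∫ y, |G y j k / c - if j = k then 1 else 0| ∂(gaussianTuple q S) := by
        rw [integral_finsetSum _ fun i _ => integrable_finsetSum _ fun j _ =>
          integrable_finsetSum _ fun k _ => (hGint j k).const_mul _]
        refine Finset.sum_congr rfl fun i _ => ?_
        rw [integral_finsetSum _ fun j _ =>
          integrable_finsetSum _ fun k _ => (hGint j k).const_mul _]
        refine Finset.sum_congr rfl fun j _ => ?_
        rw [integral_finsetSum _ fun k _ => (hGint j k).const_mul _]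
        refine Finset.sum_congr rfl fun k _ => integral_const_mul _ _
    _ ≤ ∑ i, ∑ j, ∑ k, |θ (i, j) * θ (i, k)| * √((S ^ 4).trace / c ^ 2 * gramConst) := by
        gcongr with i _ j _ k _
        exact hG j k
    _ = _ := by simp_rw [Finset.sum_mul]

end CharFun

/-! ### Convergence in probability to a constant. -/

section ConvergenceInMeasure

variable {Ω : Type*} [MeasurableSpace Ω] {μ : Measure Ω}

lemma tendstoInMeasure_comp_of_continuousAt {ι E F : Type*} [PseudoMetricSpace E]
    [PseudoMetricSpace F] {l : Filter ι} {X : ι → Ω → E} {c : E} {f : E → F}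
    (h : TendstoInMeasure μ X l fun _ => c) (hf : ContinuousAt f c) :
    TendstoInMeasure μ (fun n ω => f (X n ω)) l fun _ => f c := by
  rw [tendstoInMeasure_iff_dist] at h ⊢
  intro ε hε
  obtain ⟨δ, hδ, hfδ⟩ := Metric.continuousAt_iff.1 hf ε hε
  refine tendsto_of_tendsto_of_tendsto_of_le_of_le tendsto_const_nhds (h δ hδ)
    (fun _ => zero_le) fun n => measure_mono fun ω hω => ?_
  by_contra hlt
  exact absurd (hfδ (not_le.1 hlt)) (not_lt.2 hω)

/-- Markov's inequality, after bounding the sup distance by the sum of the entrywise distances. -/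
lemma tendstoInMeasure_of_tendsto_integral_abs [IsFiniteMeasure μ] {m : ℕ}
    {X : ℕ → Ω → Fin m → Fin m → ℝ} {c : Fin m → Fin m → ℝ}
    (hi : ∀ n i j, Integrable (fun ω => X n ω i j) μ)
    (h : ∀ i j, Tendsto (fun n => ∫ ω, |X n ω i j - c i j| ∂μ) atTop (𝓝 0)) :
    TendstoInMeasure μ X atTop fun _ => c := by
  rw [tendstoInMeasure_iff_measureReal_dist]
  intro ε hε
  have hi' : ∀ n i j, Integrable (fun ω => |X n ω i j - c i j|) μ := fun n i j =>
    ((hi n i j).sub (integrable_const _)).abs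
  have hlim : Tendsto (fun n => ε⁻¹ * ∑ i, ∑ j, ∫ ω, |X n ω i j - c i j| ∂μ) atTop (𝓝 0) := by
    have := (tendsto_finsetSum Finset.univ fun i _ =>
      tendsto_finsetSum Finset.univ fun j _ => h i j).const_mul ε⁻¹
    simpa using this
  refine squeeze_zero (fun _ => measureReal_nonneg) (fun n => ?_) hlim
  have hle : ∀ ω, dist (X n ω) c ≤ ∑ i, ∑ j, |X n ω i j - c i j| := fun ω => by
    have h0 : ∀ i, 0 ≤ ∑ j, |X n ω i j - c i j| := fun i =>
      Finset.sum_nonneg fun j _ => abs_nonneg _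
    refine (dist_pi_le_iff (Finset.sum_nonneg fun i _ => h0 i)).2 fun i => ?_
    refine le_trans ?_ (Finset.single_le_sum (fun i _ => h0 i) (Finset.mem_univ i))
    refine (dist_pi_le_iff (h0 i)).2 fun j => ?_
    exact Finset.single_le_sum (f := fun j => |X n ω i j - c i j|) (fun j _ => abs_nonneg _)
      (Finset.mem_univ j)
  have hmk := mul_meas_ge_le_integral_of_nonneg (μ := μ)
    (f := fun ω => ∑ i, ∑ j, |X n ω i j - c i j|)
    (ae_of_all _ fun ω => Finset.sum_nonneg fun i _ => Finset.sum_nonneg fun j _ => abs_nonneg _)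
    (integrable_finsetSum _ fun i _ => integrable_finsetSum _ fun j _ => hi' n i j) ε
  rw [integral_finsetSum _ fun i _ => integrable_finsetSum _ fun j _ => hi' n i j] at hmk
  simp_rw [integral_finsetSum _ fun j _ => hi' n _ j] at hmk
  rw [inv_mul_eq_div, le_div_iff₀ hε, mul_comm]
  refine le_trans ?_ hmk
  exact mul_le_mul_of_nonneg_left
    (measureReal_mono (fun ω hω => le_trans hω (hle ω)) (measure_ne_top _ _)) hε.le

end ConvergenceInMeasure

/-! ### Continuity, measurability and scaling of the matrix inverse. -/

section MatrixInverse

variable {m : ℕ}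

lemma continuousAt_matrix_inv_one :
    ContinuousAt (fun (N : Fin m → Fin m → ℝ) i j => (Matrix.of N)⁻¹ i j)
      fun i j => (1 : Matrix (Fin m) (Fin m) ℝ) i j := by
  refine continuousAt_matrix_inv (1 : Matrix (Fin m) (Fin m) ℝ) ?_
  rw [Ring.inverse_eq_inv']
  exact continuousAt_inv₀ (by simp)

lemma measurable_matrix_inv :
    Measurable (fun (N : Fin m → Fin m → ℝ) i j => (Matrix.of N)⁻¹ i j) := by
  refine measurable_pi_lambda _ fun i => measurable_pi_lambda _ fun j => ?_
  have h1 : Continuous fun N : Fin m → Fin m → ℝ => (Matrix.of N).det :=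
    Continuous.matrix_det continuous_id
  have h2 : Continuous fun N : Fin m → Fin m → ℝ => (Matrix.of N).adjugate i j :=
    (Continuous.matrix_adjugate (A := fun N : Fin m → Fin m → ℝ => Matrix.of N)
      continuous_id).matrix_elem i j
  simp_rw [inv_def, Ring.inverse_eq_inv', Matrix.smul_apply, smul_eq_mul]
  exact h1.measurable.inv.mul h2.measurable

lemma matrix_inv_smul {a : ℝ} (ha : a ≠ 0) (N : Matrix (Fin m) (Fin m) ℝ) :
    (a • N)⁻¹ = a⁻¹ • N⁻¹ := by
  by_cases h : IsUnit N.det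
  · have := invertibleOfNonzero ha
    rw [inv_smul _ _ h, invOf_eq_inv]
  · rw [nonsing_inv_apply_not_isUnit _ h, nonsing_inv_apply_not_isUnit, smul_zero]
    rw [det_smul, isUnit_iff_ne_zero] at *
    simpa using fun _ => h

end MatrixInverse

/-! ### The scaled root as a continuous function of two convergent quantities. -/

section Root

open scoped Matrix.Norms.L2Operator

variable {p m q : ℕ}

/-- For a rank-deficient `X` both sides are zero. -/
lemma betaLargestRoot_gram_eq (hm : 1 ≤ m) (X : Matrix (Fin p) (Fin m) ℝ)
    (Y : Matrix (Fin p) (Fin q) ℝ) :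
    betaLargestRoot m (X * Xᵀ) (Y * Yᵀ) = ‖Yᵀ * X * (Xᵀ * X)⁻¹‖ ^ 2 := by
  by_cases hX : (Xᵀ * X).det = 0
  · rw [betaLargestRoot_eq_zero fun h => det_transpose_mul_self_ne_zero h hX,
      nonsing_inv_apply_not_isUnit _ (by simpa using hX)]
    simp
  · exact betaLargestRoot_gram hm X Y hX

/-- The squared operator norm of `C N`, `C` being the transpose of the `m × q` matrix with
entries `c`. -/
def sqNormMul (z : EuclideanSpace ℝ (Fin m × Fin q) × (Fin m → Fin m → ℝ)) : ℝ :=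
  ‖(Matrix.of fun j i => z.1 (i, j) : Matrix (Fin q) (Fin m) ℝ) *
    (Matrix.of z.2 : Matrix (Fin m) (Fin m) ℝ)‖ ^ 2

lemma continuous_sqNormMul :
    Continuous (sqNormMul : EuclideanSpace ℝ (Fin m × Fin q) × (Fin m → Fin m → ℝ) → ℝ) := by
  unfold sqNormMul
  refine (continuous_norm.comp (Continuous.matrix_mul ?_ ?_)).pow 2
  · exact continuous_matrix fun i j => by
      simp only [of_apply]
      fun_prop
  · exact continuous_matrix fun i j => by
      simp only [of_apply]
      fun_prop

/-- The entries of `Xᵀ X / t`. -/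
def scaledGram (t : ℝ) (x : Fin m → EuclideanSpace ℝ (Fin p)) : Fin m → Fin m → ℝ :=
  fun i j => ((x i).ofLp ⬝ᵥ (x j).ofLp) / t

lemma continuous_scaledGram (t : ℝ) :
    Continuous (scaledGram t : (Fin m → EuclideanSpace ℝ (Fin p)) → _) := by
  unfold scaledGram
  fun_prop

/-- In `p b = (tr S)² / tr S²` the numerator is absorbed by the inverse of `Xᵀ X` and the
denominator by `Yᵀ X`. -/
lemma betaLargestRoot_eq_sqNormMul (hp : 1 ≤ p) (hm : 1 ≤ m) {S : Matrix (Fin p) (Fin p) ℝ}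
    (hS : S.PosDef) (x : Fin m → EuclideanSpace ℝ (Fin p)) (y : Fin q → EuclideanSpace ℝ (Fin p)) :
    p * scaleCorrection S * betaLargestRoot m (columnMatrix x * (columnMatrix x)ᵀ)
      (columnMatrix y * (columnMatrix y)ᵀ) =
    sqNormMul (crossVec √((S ^ 2).trace) x y,
      fun i j => (Matrix.of (scaledGram S.trace x))⁻¹ i j) := by
  have ht : 0 < S.trace := by simpa using trace_pow_pos hp hS 1
  have hc : 0 < (S ^ 2).trace := trace_pow_pos hp hS 2
  set c := (S ^ 2).trace
  set X := columnMatrix x with hX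
  set Y := columnMatrix y with hY
  have h1 : (Matrix.of fun j i => (crossVec (√c) x y) (i, j) : Matrix (Fin q) (Fin m) ℝ) =
      (√c)⁻¹ • (Yᵀ * X) := by
    ext j i
    simp [crossVec, hX, hY, columnMatrix, mul_apply, dotProduct, div_eq_inv_mul, mul_comm]
  have h2 : (Matrix.of (scaledGram S.trace x) : Matrix (Fin m) (Fin m) ℝ) =
      (S.trace)⁻¹ • (Xᵀ * X) := by
    ext j i
    simp [scaledGram, hX, columnMatrix, mul_apply, dotProduct, div_eq_inv_mul]
  rw [betaLargestRoot_gram_eq hm, mul_scaleCorrection_eq hp, sqNormMul, h1]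
  change _ = ‖(√c)⁻¹ • (Yᵀ * X) * (Matrix.of (scaledGram S.trace x))⁻¹‖ ^ 2
  rw [h2, matrix_inv_smul (inv_ne_zero ht.ne'), inv_inv, Matrix.smul_mul, Matrix.mul_smul,
    norm_smul, norm_smul, mul_pow, mul_pow, Real.norm_eq_abs, Real.norm_eq_abs, sq_abs, sq_abs,
    inv_pow, Real.sq_sqrt hc.le]
  ring

lemma sqNormMul_flattenVec_one (hq : 1 ≤ q) (z : Fin m → EuclideanSpace ℝ (Fin q)) :
    sqNormMul (flattenVec z, fun i j => (1 : Matrix (Fin m) (Fin m) ℝ) i j) =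
      maxEig (columnMatrix z * (columnMatrix z)ᵀ) := by
  rw [maxEig_mul_transpose_self hq, sqNormMul]
  congr 2
  exact Matrix.mul_one _

end Root

/-! ### The limit on a common probability space. -/

section Limit

variable {m q : ℕ}

/-- Convergence in distribution only depends on the laws. -/
lemma tendstoInDistribution_of_map_eq {E Ω₁' Ω₂' : Type*} [TopologicalSpace E]
    [MeasurableSpace E] [OpensMeasurableSpace E] {Ω₁ Ω₂ : ℕ → Type*}
    [∀ n, MeasurableSpace (Ω₁ n)] [∀ n, MeasurableSpace (Ω₂ n)] [MeasurableSpace Ω₁']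
    [MeasurableSpace Ω₂'] {μ₁ : ∀ n, Measure (Ω₁ n)} {μ₂ : ∀ n, Measure (Ω₂ n)}
    [∀ n, IsProbabilityMeasure (μ₁ n)] [∀ n, IsProbabilityMeasure (μ₂ n)]
    {ν₁ : Measure Ω₁'} {ν₂ : Measure Ω₂'} [IsProbabilityMeasure ν₁] [IsProbabilityMeasure ν₂]
    {X₁ : ∀ n, Ω₁ n → E} {X₂ : ∀ n, Ω₂ n → E} {Z₁ : Ω₁' → E} {Z₂ : Ω₂' → E}
    (h : TendstoInDistribution X₁ atTop Z₁ μ₁ ν₁) (hX₂ : ∀ n, AEMeasurable (X₂ n) (μ₂ n))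
    (hZ₂ : AEMeasurable Z₂ ν₂) (hX : ∀ᶠ n in atTop, (μ₂ n).map (X₂ n) = (μ₁ n).map (X₁ n))
    (hZ : ν₂.map Z₂ = ν₁.map Z₁) : TendstoInDistribution X₂ atTop Z₂ μ₂ ν₂ where
  forall_aemeasurable := hX₂
  aemeasurable_limit := hZ₂
  tendsto := by
    have h1 : (⟨ν₂.map Z₂, Measure.isProbabilityMeasure_map hZ₂⟩ : ProbabilityMeasure E) =
        ⟨ν₁.map Z₁, Measure.isProbabilityMeasure_map h.aemeasurable_limit⟩ := Subtype.ext hZ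
    rw [h1]
    refine h.tendsto.congr' ?_
    filter_upwards [hX] with n hn
    exact Subtype.ext hn.symm

variable (m q) in
/-- A common probability space carrying the samples for all dimensions. -/
abbrev sampleMeasure (S : (p : ℕ) → Matrix (Fin p) (Fin p) ℝ) :
    Measure ((p : ℕ) → (Fin m → EuclideanSpace ℝ (Fin p)) × (Fin q → EuclideanSpace ℝ (Fin p))) :=
  Measure.infinitePi fun p => (gaussianTuple m (S p)).prod (gaussianTuple q (S p))

variable {S : (p : ℕ) → Matrix (Fin p) (Fin p) ℝ}

lemma map_eval_sampleMeasure {E : Type*} [MeasurableSpace E] (p : ℕ)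
    {f : (Fin m → EuclideanSpace ℝ (Fin p)) × (Fin q → EuclideanSpace ℝ (Fin p)) → E}
    (hf : AEMeasurable f ((gaussianTuple m (S p)).prod (gaussianTuple q (S p)))) :
    (sampleMeasure m q S).map (fun ω => f (ω p)) =
      ((gaussianTuple m (S p)).prod (gaussianTuple q (S p))).map f := by
  have h := measurePreserving_eval_infinitePi
    (fun p => (gaussianTuple m (S p)).prod (gaussianTuple q (S p))) p
  rw [← h.map_eq] at hf ⊢
  rw [AEMeasurable.map_map_of_aemeasurable hf h.measurable.aemeasurable]
  rfl

lemma tendstoInDistribution_crossVec (hS : ∀ p, (S p).PosDef)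
    (hS4 : Tendsto (fun p => (S p ^ 4).trace / (S p ^ 2).trace ^ 2) atTop (𝓝 0)) :
    TendstoInDistribution
      (fun p (ω : (p : ℕ) → (Fin m → EuclideanSpace ℝ (Fin p)) ×
        (Fin q → EuclideanSpace ℝ (Fin p))) => crossVec √((S p ^ 2).trace) (ω p).1 (ω p).2)
      atTop flattenVec (fun _ => sampleMeasure m q S)
      (gaussianTuple m (1 : Matrix (Fin q) (Fin q) ℝ)) where
  forall_aemeasurable p :=
    ((continuous_crossVec _).measurable.comp (measurable_pi_apply p)).aemeasurable
  aemeasurable_limit := continuous_flattenVec.aemeasurable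
  tendsto := by
    refine ProbabilityMeasure.tendsto_of_tendsto_charFun fun θ => ?_
    rw [tendsto_iff_norm_sub_tendsto_zero]
    have hlim : Tendsto (fun p => (∑ i, ∑ j, ∑ k, |θ (i, j) * θ (i, k)|) *
        √((S p ^ 4).trace / (S p ^ 2).trace ^ 2 * gramConst)) atTop (𝓝 0) := by
      have := ((hS4.mul_const gramConst).sqrt).const_mul (∑ i, ∑ j, ∑ k, |θ (i, j) * θ (i, k)|)
      simpa using this
    refine squeeze_zero' (Eventually.of_forall fun _ => norm_nonneg _) ?_ hlim
    filter_upwards [eventually_ge_atTop 1] with p hp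
    simp only [ProbabilityMeasure.coe_mk]
    rw [map_eval_sampleMeasure p (f := fun z => crossVec √((S p ^ 2).trace) z.1 z.2)
      (continuous_crossVec _).aemeasurable]
    exact norm_charFun_crossVec_sub_le hp (hS p) θ

lemma tendstoInMeasure_scaledGram (hS : ∀ p, (S p).PosDef)
    (hS4 : Tendsto (fun p => (S p ^ 4).trace / (S p ^ 2).trace ^ 2) atTop (𝓝 0)) :
    TendstoInMeasure (sampleMeasure m q S)
      (fun p ω => scaledGram (S p).trace (ω p).1) atTop
      fun _ i j => (1 : Matrix (Fin m) (Fin m) ℝ) i j := by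
  have hmp : ∀ p, MeasurePreserving (fun ω : (p : ℕ) → (Fin m → EuclideanSpace ℝ (Fin p)) ×
      (Fin q → EuclideanSpace ℝ (Fin p)) => (ω p).1) (sampleMeasure m q S)
      (gaussianTuple m (S p)) := fun p =>
    measurePreserving_fst.comp (measurePreserving_eval_infinitePi
      (fun p => (gaussianTuple m (S p)).prod (gaussianTuple q (S p))) p)
  refine tendstoInMeasure_of_tendsto_integral_abs (fun p i j => ?_) fun i j => ?_
  · have h := (integrable_gram (S p) (R := 1) (hS p).posSemidef transpose_one i j).div_const
      (S p).trace
    simp only [one_mulVec] at h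
    exact (hmp p).integrable_comp_of_integrable h
  · have hlim : Tendsto (fun p => √((S p ^ 4).trace / (S p ^ 2).trace ^ 2 * gramConst)) atTop
        (𝓝 0) := by
      simpa using (hS4.mul_const gramConst).sqrt
    refine squeeze_zero' (Eventually.of_forall fun _ => integral_nonneg fun _ => abs_nonneg _)
      ?_ hlim
    filter_upwards [eventually_ge_atTop 1] with p hp
    have ht : 0 < (S p).trace := by simpa using trace_pow_pos hp (hS p) 1
    have hc : 0 < (S p ^ 2).trace := trace_pow_pos hp (hS p) 2
    have h := integral_abs_gram_sub_le (R := 1) (hS p).posSemidef transpose_one i j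
    simp only [one_mulVec, Matrix.one_mul, Matrix.mul_one] at h
    rw [← sq] at h
    have e : ∫ ω, |scaledGram (S p).trace (ω p).1 i j - (1 : Matrix (Fin m) (Fin m) ℝ) i j|
        ∂(sampleMeasure m q S) =
        (∫ v, |(v i).ofLp ⬝ᵥ (v j).ofLp - if i = j then (S p).trace else 0|
          ∂(gaussianTuple m (S p))) / (S p).trace := by
      rw [← (hmp p).map_eq, integral_map (hmp p).measurable.aemeasurable
        (Continuous.aestronglyMeasurable (by fun_prop)), ← integral_div]
      refine integral_congr_ae (ae_of_all _ fun ω => ?_)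
      simp only
      rw [← abs_of_pos ht, ← abs_div, abs_of_pos ht, scaledGram, one_apply]
      congr 1
      split_ifs
      · field_simp
      · simp
    have hg : 0 ≤ gramConst := add_nonneg (variance_nonneg _ _) zero_le_one
    rw [e]
    calc _ ≤ √((S p ^ 2).trace * gramConst) / (S p).trace := by gcongr
      _ = √((S p ^ 2).trace / (S p).trace ^ 2 * gramConst) := by
        rw [div_mul_eq_mul_div, Real.sqrt_div' _ (sq_nonneg _), Real.sqrt_sq ht.le]
      _ ≤ _ := by
        apply Real.sqrt_le_sqrt
        -- The law of large numbers with `R = 1` yields `tr S² / (tr S)²`, compared here with the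
        -- ratio assumed to vanish.
        gcongr ?_ * _
        rw [div_le_div_iff₀ (by positivity) (by positivity)]
        linarith [trace_sq_cube_le (hS p).posSemidef]

lemma tendstoInDistribution_sqNormMul (hS : ∀ p, (S p).PosDef)
    (hS4 : Tendsto (fun p => (S p ^ 4).trace / (S p ^ 2).trace ^ 2) atTop (𝓝 0)) :
    TendstoInDistribution
      (fun p (ω : (p : ℕ) → (Fin m → EuclideanSpace ℝ (Fin p)) ×
        (Fin q → EuclideanSpace ℝ (Fin p))) =>
        sqNormMul (crossVec √((S p ^ 2).trace) (ω p).1 (ω p).2,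
          fun i j => (Matrix.of (scaledGram (S p).trace (ω p).1))⁻¹ i j))
      atTop (fun z => sqNormMul (flattenVec z, fun i j => (1 : Matrix (Fin m) (Fin m) ℝ) i j))
      (fun _ => sampleMeasure m q S) (gaussianTuple m (1 : Matrix (Fin q) (Fin q) ℝ)) := by
  -- Slutsky's theorem. The two factors share `X` and are dependent, which is harmless because one
  -- limit is constant.
  refine (tendstoInDistribution_crossVec hS hS4).continuous_comp_prodMk_of_tendstoInMeasure_const
    continuous_sqNormMul ?_ fun p => ?_
  · have h := tendstoInMeasure_comp_of_continuousAt
      (tendstoInMeasure_scaledGram (m := m) (q := q) hS hS4) continuousAt_matrix_inv_one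
    have e : (fun i j => (Matrix.of fun i j => (1 : Matrix (Fin m) (Fin m) ℝ) i j)⁻¹ i j) =
        fun i j => (1 : Matrix (Fin m) (Fin m) ℝ) i j := by
      change (fun i j => (1 : Matrix (Fin m) (Fin m) ℝ)⁻¹ i j) = _
      rw [inv_one]
    rwa [e] at h
  · exact (measurable_matrix_inv.comp ((continuous_scaledGram _).measurable.comp
      (measurable_fst.comp (measurable_pi_apply p)))).aemeasurable

end Limit

/-! ### Transfer to arbitrary Wishart variables. -/

lemma measurable_columnMatrix_gram {k n : ℕ} :
    Measurable fun v : Fin n → EuclideanSpace ℝ (Fin k) =>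
      columnMatrix v * (columnMatrix v)ᵀ := by
  have : Continuous fun v : Fin n → EuclideanSpace ℝ (Fin k) => columnMatrix v :=
    continuous_matrix fun i j => by
      simp only [columnMatrix, of_apply]
      fun_prop
  exact Continuous.measurable (by fun_prop)

/-- A continuous image of a σ-compact space is σ-compact, hence Borel here. Measurability lets "is a
Gram matrix" be pulled back along the map defining the law. -/
lemma measurableSet_gram {p m : ℕ} :
    MeasurableSet {M : Matrix (Fin p) (Fin p) ℝ | ∃ X : Matrix (Fin p) (Fin m) ℝ, M = X * Xᵀ} := by
  have : SigmaCompactSpace (Matrix (Fin p) (Fin m) ℝ) :=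
    inferInstanceAs (SigmaCompactSpace (Fin p → Fin m → ℝ))
  have hc : Continuous fun X : Matrix (Fin p) (Fin m) ℝ => X * Xᵀ := by fun_prop
  obtain ⟨K, hK, hKU⟩ := isSigmaCompact_range hc
  have e : {M : Matrix (Fin p) (Fin p) ℝ | ∃ X : Matrix (Fin p) (Fin m) ℝ, M = X * Xᵀ} =
      ⋃ n, K n := by
    rw [hKU]
    ext z
    simp only [Set.mem_ofPred_eq, Set.mem_range, eq_comm]
  rw [e]
  exact MeasurableSet.iUnion fun n => (hK n).measurableSet

lemma measurableSet_gram_pairs {p m q : ℕ} :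
    MeasurableSet {z : Matrix (Fin p) (Fin p) ℝ × Matrix (Fin p) (Fin p) ℝ |
      ∃ (X : Matrix (Fin p) (Fin m) ℝ) (Y : Matrix (Fin p) (Fin q) ℝ),
        z = (X * Xᵀ, Y * Yᵀ)} := by
  convert! (measurableSet_gram (p := p) (m := m)).prod (measurableSet_gram (p := p) (m := q)) using 1
  ext ⟨A, B⟩
  simp [Set.mem_prod]

open scoped Matrix.Norms.L2Operator in
lemma aemeasurable_maxEig_wishart {k n : ℕ} (hk : 1 ≤ k) (S : Matrix (Fin k) (Fin k) ℝ) :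
    AEMeasurable (maxEig : Matrix (Fin k) (Fin k) ℝ → ℝ) (wishart k n S) := by
  refine ⟨fun M => ‖M‖, continuous_norm.measurable, ?_⟩
  have h : ∀ᵐ M ∂(wishart k n S), ∃ X : Matrix (Fin k) (Fin n) ℝ, M = X * Xᵀ := by
    rw [wishart, ae_map_iff measurable_columnMatrix_gram.aemeasurable measurableSet_gram]
    exact ae_of_all _ fun v => ⟨_, rfl⟩
  filter_upwards [h] with M hM
  obtain ⟨X, rfl⟩ := hM
  refine maxEig_eq_norm_of_posSemidef hk ?_
  have := posSemidef_self_mul_conjTranspose X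
  rwa [conjTranspose_eq_transpose_of_trivial] at this

end

theorem theorem2 (m q : ℕ) (hm : 1 ≤ m) (hq : 1 ≤ q)
    (S : (p : ℕ) → Matrix (Fin p) (Fin p) ℝ) (hS : ∀ p, (S p).PosDef)
    (hS4 : Tendsto (fun p : ℕ => scaleMoment (S p) 4 / (p * scaleMoment (S p) 2 ^ 2)) atTop (𝓝 0))
    {Ω : ℕ → Type*} [∀ p, MeasurableSpace (Ω p)]
    (P : (p : ℕ) → Measure (Ω p)) [∀ p, IsProbabilityMeasure (P p)]
    (A B : (p : ℕ) → Ω p → Matrix (Fin p) (Fin p) ℝ)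
    (hA : ∀ p, HasLaw (A p) (wishart p m (S p)) (P p))
    (hB : ∀ p, HasLaw (B p) (wishart p q (S p)) (P p))
    (hAB : ∀ p, IndepFun (A p) (B p) (P p))
    {Ω' : Type*} [MeasurableSpace Ω'] (P' : Measure Ω') [IsProbabilityMeasure P']
    (W : Ω' → Matrix (Fin q) (Fin q) ℝ) (hW : HasLaw W (wishart q m 1) P') :
    TendstoInDistribution
      (fun (p : ℕ) (ω : Ω p) =>
        (p * scaleCorrection (S p)) * betaLargestRoot m (A p ω) (B p ω))
      atTop (fun ω => maxEig (W ω)) P P' := by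
  have hS4' : Tendsto (fun p => (S p ^ 4).trace / (S p ^ 2).trace ^ 2) atTop (𝓝 0) := by
    refine hS4.congr' ?_
    filter_upwards [eventually_ge_atTop 1] with p hp
    exact scaleMoment_ratio_eq hp (S p)
  have hgm : ∀ p, Measurable fun z : (Fin m → EuclideanSpace ℝ (Fin p)) ×
      (Fin q → EuclideanSpace ℝ (Fin p)) => (columnMatrix z.1 * (columnMatrix z.1)ᵀ,
        columnMatrix z.2 * (columnMatrix z.2)ᵀ) := fun p =>
    (measurable_columnMatrix_gram.comp measurable_fst).prodMk
      (measurable_columnMatrix_gram.comp measurable_snd)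
  have hlaw : ∀ p, (P p).map (fun ω => (A p ω, B p ω)) =
      ((gaussianTuple m (S p)).prod (gaussianTuple q (S p))).map fun z =>
        (columnMatrix z.1 * (columnMatrix z.1)ᵀ, columnMatrix z.2 * (columnMatrix z.2)ᵀ) :=
    fun p => by
      rw [(indepFun_iff_map_prod_eq_prod_map_map (hA p).aemeasurable (hB p).aemeasurable).1 (hAB p),
        (hA p).map_eq, (hB p).map_eq, wishart, wishart,
        Measure.map_prod_map _ _ measurable_columnMatrix_gram measurable_columnMatrix_gram]
      rfl
  have hroot : ∀ p, AEMeasurable (fun z => p * scaleCorrection (S p) * betaLargestRoot m z.1 z.2)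
      ((P p).map (fun ω => (A p ω, B p ω))) := fun p => by
    refine (aemeasurable_betaLargestRoot (q := q) hm ?_).const_mul _
    rw [hlaw p, ae_map_iff (hgm p).aemeasurable measurableSet_gram_pairs]
    exact ae_of_all _ fun z => ⟨_, _, rfl⟩
  have hAB' : ∀ p, AEMeasurable (fun ω => (A p ω, B p ω)) (P p) := fun p =>
    (hA p).aemeasurable.prodMk (hB p).aemeasurable
  have hmax : AEMeasurable (maxEig : Matrix (Fin q) (Fin q) ℝ → ℝ) (wishart q m 1) :=
    aemeasurable_maxEig_wishart hq 1
  have hmax' : AEMeasurable maxEig (P'.map W) := by rwa [hW.map_eq]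
  -- Only the laws matter, so the `Ω p` are replaced by the common space carrying explicit Gaussian
  -- samples.
  refine tendstoInDistribution_of_map_eq (tendstoInDistribution_sqNormMul (q := q) (m := m) hS hS4')
    (fun p => (hroot p).comp_aemeasurable (hAB' p)) ?_ ?_ ?_
  · exact hmax'.comp_aemeasurable hW.aemeasurable
  -- The traces vanish for `p = 0`, so the identity with `sqNormMul` is used for `p ≥ 1` only.
  · filter_upwards [eventually_ge_atTop 1] with p hp
    have h1 := AEMeasurable.map_map_of_aemeasurable (hroot p) (hAB' p)
    rw [hlaw p, AEMeasurable.map_map_of_aemeasurable (by rw [← hlaw p]; exact hroot p)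
      (hgm p).aemeasurable] at h1
    refine h1.symm.trans ?_
    have h2 : ((fun z : Matrix (Fin p) (Fin p) ℝ × Matrix (Fin p) (Fin p) ℝ =>
        p * scaleCorrection (S p) * betaLargestRoot m z.1 z.2) ∘
        fun z : (Fin m → EuclideanSpace ℝ (Fin p)) × (Fin q → EuclideanSpace ℝ (Fin p)) =>
          (columnMatrix z.1 * (columnMatrix z.1)ᵀ, columnMatrix z.2 * (columnMatrix z.2)ᵀ)) =
        fun z => sqNormMul (crossVec √((S p ^ 2).trace) z.1 z.2,
          fun i j => (Matrix.of (scaledGram (S p).trace z.1))⁻¹ i j) :=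
      funext fun z => betaLargestRoot_eq_sqNormMul hp hm (hS p) z.1 z.2
    rw [h2]
    refine (map_eval_sampleMeasure p (Measurable.aemeasurable ?_)).symm
    exact continuous_sqNormMul.measurable.comp ((continuous_crossVec _).measurable.prodMk
      (measurable_matrix_inv.comp ((continuous_scaledGram _).measurable.comp measurable_fst)))
  · have h1 := AEMeasurable.map_map_of_aemeasurable hmax' hW.aemeasurable
    refine h1.symm.trans ?_
    rw [hW.map_eq, wishart, AEMeasurable.map_map_of_aemeasurable hmax
      measurable_columnMatrix_gram.aemeasurable]
    congr 1
    exact funext fun z => (sqNormMul_flattenVec_one hq z).symm
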